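/- Let $r\ge 1$ and let $f,g\in \mathrm{M}_r(\mathbb{C})[Z]$ be polynomials in one variable with coefficients in the ring $\mathrm{M}_r(\mathbb{C})$ of complex $r\times r$ matrices. For $f=C_dZ^d+\cdots+C_1Z+C_0$ and $A\in \mathrm{M}_r(\mathbb{C})$ write $f(A)=C_dA^d+\cdots+C_1A+C_0$, and $f(xI)=C_dx^d+\cdots+C_1x+C_0\in \mathrm{M}_r(\mathbb{C}[x])$, where $I$ is the identity matrix; similarly for $g$. Assume that every eigenvalue $\mu\in\overline{\mathbb{C}(x)}$ of $f(xI)$ and every eigenvalue $\eta\in\overline{\mathbb{C}(x)}$ of $g(xI)$ are multiplicatively independent, that is, there is no pair of integers $(k_1,k_2)\ne(0,0)$ with $\mu^{k_1}\eta^{k_2}=1$. Then the matrices $A\in \mathrm{M}_r(\mathbb{C})$ such that - $A$ commutes with every coefficient of $f$ and every coefficient of $g$, and - $(f(A),g(A))$ is a torsion point, that is, $f(A)^n=I$ and $g(A)^m=I$ for some integers $n,m\ge 1$, lie in at most $$2\left(22\,r^{5}\,(\deg f+\deg g)\,\deg f\cdot\deg g\right)^r$$ conjugacy classes of $\mathrm{M}_r(\mathbb{C})$,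 where $A$ and $B$ are conjugate if $A=VBV^{-1}$ for some invertible $V\in \mathrm{M}_r(\mathbb{C})$. (The zero polynomial is given degree $0$.) -/

import Mathlib

open Polynomial

noncomputable section

/-- The ring `M_r(ℂ)` of complex `r × r` matrices. -/
abbrev CMat (r : ℕ) : Type := Matrix (Fin r) (Fin r) ℂ

/-- A fixed algebraic closure of the field of rational functions `ℂ(x)`: the field of algebraic
functions in the variable `x`. -/
abbrev AlgFun : Type := AlgebraicClosure (RatFunc ℂ)

/-- The variable `x`, regarded as an algebraic function. -/
def AlgFun.x : AlgFun := algebraMap (RatFunc ℂ) AlgFun RatFunc.X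

/-- For a matrix polynomial `f = C_d Z ^ d + ⋯ + C_0`, the matrix
`f(xI) = C_d (xI) ^ d + ⋯ + C_0`, with entries regarded as algebraic functions. -/
def atScalarVariable {r : ℕ} (f : (CMat r)[X]) : Matrix (Fin r) (Fin r) AlgFun :=
  f.eval₂ (algebraMap ℂ AlgFun).mapMatrix (Matrix.scalar (Fin r) AlgFun.x)

/-- `μ` is an eigenvalue of the matrix `f(xI)` in the field of algebraic functions. -/
def IsEigenvalueAtScalarVariable {r : ℕ} (f : (CMat r)[X]) (μ : AlgFun) : Prop :=
  Module.End.HasEigenvalue (Matrix.toLin' (atScalarVariable f)) μ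

/-- Two algebraic functions are multiplicatively dependent if `h₁ ^ k₁ * h₂ ^ k₂ = 1` for some
pair of integers `(k₁, k₂) ≠ (0, 0)`. (The zero function satisfies no relation in which it occurs
with a nonzero exponent, since `0 ^ k = 0` for every integer `k ≠ 0`.) -/
def MultDependent (h₁ h₂ : AlgFun) : Prop :=
  ∃ k : ℤ × ℤ, k ≠ 0 ∧ h₁ ^ k.1 * h₂ ^ k.2 = 1

/-- Two algebraic functions are multiplicatively independent if they are not multiplicatively
dependent. -/
def MultIndependent (h₁ h₂ : AlgFun) : Prop := ¬ MultDependent h₁ h₂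

/-- A pair of matrices is a torsion point if each of them has a power with positive exponent that
is the identity matrix; such matrices are in particular invertible. -/
def IsTorsionPoint {r : ℕ} (A B : CMat r) : Prop :=
  (∃ n : ℕ, 1 ≤ n ∧ A ^ n = 1) ∧ (∃ m : ℕ, 1 ≤ m ∧ B ^ m = 1)

/-- The matrices `A` that commute with all coefficients of `f` and `g` and for which
`(f(A), g(A))` is a torsion point. Here `f.eval A = ∑ i, f.coeff i * A ^ i`. -/
def commutingTorsionSet {r : ℕ} (f g : (CMat r)[X]) : Set (CMat r) :=
  {A | (∀ i, Commute A (f.coeff i)) ∧ (∀ i, Commute A (g.coeff i)) ∧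
    IsTorsionPoint (f.eval A) (g.eval A)}

end

/-! Write F(x,Y) and G(x,Z) for the characteristic polynomials of f(xI) and g(xI). If A lies in the
set and l is an eigenvalue of A, then f(A) preserves the l-eigenspace of A and acts on it as f(lI).
So F(l,·) vanishes at a root of unity y, and likewise G(l,·) at a root of unity z
(`exists_evalEval_charpolyAtScalar_eq_zero`). It suffices to catch all such l in a small finite set
S, because there are at most (2|S|)^r Jordan forms of size r with spectrum in S
(`encard_conjClasses_le`).

The pair (y,z) lies on the curve R = Res_x(F,G), of bidegree at most (r² deg g, r² deg f), and it is
a specialization of a pair (μ,η) of eigenvalues of f(xI) and g(xI) (`exists_specialization`). Since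
y and z are roots of unity, independence of μ and η improves to independence modulo constants, so
the exponents of an irreducible factor P of R vanishing at (μ,η) do not lie on a line. A bound of
Beukers–Smyth type (`exists_torsion_finset_of_irreducible`) leaves at most 22 · deg_X P · deg_Y P
values y on P. Summing over the factors, with at most r deg f values l above each y, bounds |S|;
exchanging f and g replaces deg f by the smaller degree, which is at most half the sum.

For the torsion bound with cyclotomic coefficients, a Galois conjugation turns a torsion zero of P
into a zero of a second polynomial: a conjugate of P twisted by signs, or such a twist in the
squares of the variables. The signs are quadratic characters of the lattice spanned by the exponent
differences. P does not divide the second polynomial, so a resultant counts the common zeros.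
Coefficients outside the cyclotomic closure are handled by a linear projection onto it. -/

noncomputable section

open Polynomial.Bivariate

/-! ### Bidegrees, resultants and elimination. -/

section BivariateDegree
variable {R : Type*} [CommRing R]

/-- The degree of a bivariate polynomial in its inner variable. -/
def xDegree (P : R[X][Y]) : ℕ := (swap P).natDegree

theorem coeff_coeff_swap (P : R[X][Y]) (i j : ℕ) :
    ((swap P).coeff i).coeff j = (P.coeff j).coeff i := by
  induction P using Polynomial.induction_on' with
  | add p q hp hq => simp [hp, hq]
  | monomial n a =>
    induction a using Polynomial.induction_on' with
    | add p q hp hq => simp_all [map_add]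
    | monomial m a =>
      rw [swap_monomial_monomial]
      simp only [coeff_monomial]
      split_ifs <;> simp_all [coeff_monomial]

theorem xDegree_le_iff (P : R[X][Y]) (n : ℕ) :
    xDegree P ≤ n ↔ ∀ j, (P.coeff j).natDegree ≤ n := by
  simp only [xDegree, natDegree_le_iff_coeff_eq_zero]
  constructor
  · intro h j i hi
    rw [← coeff_coeff_swap, h i hi, coeff_zero]
  · intro h i hi
    ext j
    rw [coeff_coeff_swap, h j i hi, coeff_zero]

theorem natDegree_coeff_le_xDegree (P : R[X][Y]) (j : ℕ) : (P.coeff j).natDegree ≤ xDegree P :=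
  (xDegree_le_iff P _).1 le_rfl j

theorem xDegree_mul [IsDomain R] {P Q : R[X][Y]} (hP : P ≠ 0) (hQ : Q ≠ 0) :
    xDegree (P * Q) = xDegree P + xDegree Q := by
  rw [xDegree, map_mul, natDegree_mul (by simpa using hP) (by simpa using hQ), xDegree, xDegree]

theorem xDegree_le_of_dvd [IsDomain R] {P Q : R[X][Y]} (h : P ∣ Q) (hQ : Q ≠ 0) :
    xDegree P ≤ xDegree Q := by
  obtain ⟨c, rfl⟩ := h
  rw [xDegree_mul (left_ne_zero_of_mul hQ) (right_ne_zero_of_mul hQ)]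
  exact Nat.le_add_right _ _

theorem xDegree_prod [IsDomain R] {ι : Type*} (s : Finset ι) (P : ι → R[X][Y])
    (h : ∀ i ∈ s, P i ≠ 0) : xDegree (∏ i ∈ s, P i) = ∑ i ∈ s, xDegree (P i) := by
  rw [xDegree, map_prod, natDegree_prod _ _ (fun i hi => by simpa using h i hi)]
  rfl

theorem natDegree_det_le {n : Type*} [Fintype n] [DecidableEq n] (M : Matrix n n R[X])
    (c : n → ℕ) (h : ∀ i j, (M i j).natDegree ≤ c j) : M.det.natDegree ≤ ∑ j, c j := by
  rw [Matrix.det_apply]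
  refine natDegree_sum_le_of_forall_le _ _ fun σ _ => ?_
  refine (natDegree_smul_le _ _).trans ((natDegree_prod_le _ _).trans ?_)
  exact Finset.sum_le_sum fun i _ => h _ _

/-- The Sylvester matrix has n columns of coefficients of f and m columns of coefficients of g. -/
theorem natDegree_resultant_le (f g : R[X][X]) (m n a b : ℕ) (hf : ∀ i, (f.coeff i).natDegree ≤ a)
    (hg : ∀ i, (g.coeff i).natDegree ≤ b) : (resultant f g m n).natDegree ≤ n * a + m * b := by
  refine (natDegree_det_le _ (fun j => Fin.addCases (fun _ => b) (fun _ => a) j) ?_).trans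
    (by simp [Fin.sum_univ_add, add_comm])
  intro i j
  induction j using Fin.addCases with
  | left j => simp only [sylvester, Matrix.of_apply, Fin.addCases_left]; split_ifs <;> simp [hg]
  | right j => simp only [sylvester, Matrix.of_apply, Fin.addCases_right]; split_ifs <;> simp [hf]

/-- Two bivariate polynomials without common factor have common zeros above few values of the
first coordinate. -/
theorem exists_finset_fst_of_not_dvd {k : Type*} [Field k] {P Q : k[X][Y]} (hP : Irreducible P)
    (hdeg : 0 < P.natDegree) (hPQ : ¬ P ∣ Q) {a' b' : ℕ} (ha' : xDegree Q ≤ a')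
    (hb' : Q.natDegree ≤ b') :
    ∃ T : Finset k, T.card ≤ xDegree P * b' + a' * P.natDegree ∧
      ∀ y z, P.evalEval y z = 0 → Q.evalEval y z = 0 → y ∈ T := by
  classical
  set R := resultant P Q P.natDegree Q.natDegree with hR
  have hprim : P.IsPrimitive := hP.isPrimitive hdeg.ne'
  -- By Gauss's lemma P stays irreducible over k(x), so a vanishing resultant would force P to
  -- divide Q there, hence already over k[x].
  have hR0 : R ≠ 0 := by
    intro h0
    have h1 : resultant (P.map (algebraMap k[X] (RatFunc k))) (Q.map (algebraMap k[X] (RatFunc k)))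
        = 0 := by
      have hinj := IsFractionRing.injective k[X] (RatFunc k)
      rw [natDegree_map_eq_of_injective hinj, natDegree_map_eq_of_injective hinj,
        resultant_map_map, ← hR, h0, map_zero]
    rw [resultant_eq_zero_iff] at h1
    have hirr : Irreducible (P.map (algebraMap k[X] (RatFunc k))) :=
      (hprim.irreducible_iff_irreducible_map_fraction_map).1 hP
    exact (EuclideanDomain.dvd_or_coprime _ _ hirr).elim
      (fun h => hPQ (hprim.dvd_of_fraction_map_dvd_fraction_map h)) h1.2
  refine ⟨R.roots.toFinset, ?_, ?_⟩
  · refine (Multiset.toFinset_card_le _).trans ((card_roots' R).trans ?_)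
    refine (natDegree_resultant_le P Q _ _ _ _ (natDegree_coeff_le_xDegree P)
      (fun i => (natDegree_coeff_le_xDegree Q i).trans ha')).trans ?_
    nlinarith
  · intro y z h1 h2
    obtain ⟨p, q, -, -, h⟩ := exists_mul_add_mul_eq_C_resultant P Q le_rfl le_rfl (Or.inl hdeg.ne')
    have := congrArg (evalEval y z) h
    rw [evalEval_add, evalEval_mul, evalEval_mul, h1, h2, evalEval_C] at this
    simp only [Multiset.mem_toFinset, mem_roots hR0, IsRoot.def]
    simpa using this.symm
/-- The resultant of `F(x, Y)` and `G(x, Z)` with respect to `x`, together with its degrees. -/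
theorem exists_eliminant {F G : ℂ[X][Y]} (hG : G.Monic) (hF0 : F ≠ 0)
    (hp : 0 < xDegree F) :
    ∃ R : ℂ[X][Y], R ≠ 0 ∧ xDegree R ≤ xDegree G * F.natDegree ∧
      R.natDegree ≤ xDegree F * G.natDegree ∧
      ∀ {K : Type} [CommRing K] [Algebra ℂ K] (x μ η : K), aevalAeval x μ F = 0 →
        aevalAeval x η G = 0 → aevalAeval μ η R = 0 := by
  classical
  set F' := swap F with hF'
  set G' := swap G with hG'
  -- The outermost variable is now x. The coefficients of F₁ involve only the inner remaining
  -- variable and those of G₁ only the outer one, so each degree of the resultant comes from one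
  -- block of columns.
  set F₁ : ℂ[X][Y][X] := F'.map C
  set G₁ : ℂ[X][Y][X] := G'.map (mapRingHom C)
  have hdF : F₁.natDegree ≤ xDegree F := natDegree_map_le
  have hdG : G₁.natDegree ≤ xDegree G := natDegree_map_le
  have hxF : xDegree F' = F.natDegree := by rw [xDegree, hF', swap_swap_apply]
  have hxG : xDegree G' = G.natDegree := by rw [xDegree, hG', swap_swap_apply]
  refine ⟨resultant F₁ G₁ (xDegree F) (xDegree G), ?_, ?_, ?_, ?_⟩
  · have hF'0 : F' ≠ 0 := by simpa [hF'] using hF0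
    -- Nonvanishing is tested at a point: y keeps the x-degree of F, and z avoids the roots of the
    -- monic polynomials G(l,·) for the finitely many l with F(l,y) = 0. The resultant there is a
    -- nonzero multiple of the product of the G(l,z).
    obtain ⟨y, hy⟩ : ∃ y, F'.leadingCoeff.eval y ≠ 0 := by
      by_contra! h
      exact leadingCoeff_ne_zero.2 hF'0 (Polynomial.funext fun r => by simpa using h r)
    set f₀ := F'.map (evalRingHom y) with hf₀
    have hdf₀ : f₀.natDegree = xDegree F := natDegree_map_of_leadingCoeff_ne_zero _ hy
    have hf₀0 : f₀ ≠ 0 := by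
      intro h; rw [h, natDegree_zero] at hdf₀; omega
    set B : ℂ[X] := ∏ l ∈ f₀.roots.toFinset, G.map (evalRingHom l)
    obtain ⟨z, hz⟩ : ∃ z, B.eval z ≠ 0 := by
      by_contra! h
      refine (Finset.prod_ne_zero_iff.2 fun l _ => (hG.map (evalRingHom l)).ne_zero)
        (Polynomial.funext fun r => by simpa using h r : B = 0)
    intro h0
    have h1 := congrArg (evalEvalRingHom y z) h0
    rw [← resultant_map_map, map_zero] at h1
    have hF₁ : F₁.map (evalEvalRingHom y z) = f₀ := by
      rw [Polynomial.map_map, hf₀]; congr 1; ext <;> simp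
    have hG₁ : G₁.map (evalEvalRingHom y z) = G'.map (evalRingHom z) := by
      rw [Polynomial.map_map]; congr 1; ext <;> simp
    rw [hF₁, hG₁, ← hdf₀, resultant_eq_prod_eval f₀ _ (xDegree G) natDegree_map_le (IsAlgClosed.splits _),
      mul_eq_zero, Multiset.prod_eq_zero_iff] at h1
    rcases h1 with h1 | h1
    · exact pow_ne_zero _ (leadingCoeff_ne_zero.2 hf₀0) h1
    · obtain ⟨l, hl, hl0⟩ := Multiset.mem_map.1 h1
      rw [eval_prod, Finset.prod_ne_zero_iff] at hz
      apply hz l (Multiset.mem_toFinset.2 hl)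
      have h2 : ∀ (P : ℂ[X][Y]) (a b : ℂ), (P.map (evalRingHom a)).eval b = aevalAeval a b P := by
        intro P a b
        rw [map_evalRingHom_eval, coe_aevalAeval_eq_evalEval]
      rw [h2, ← aevalAeval_swap, ← h2]
      exact hl0
  · have hs : ∀ a : ℂ[X][Y], swap a = (swap (R := ℂ)).toRingEquiv.toRingHom a := fun _ => rfl
    rw [xDegree, hs, ← resultant_map_map]
    refine (natDegree_resultant_le _ _ _ _ F.natDegree 0 (fun i => ?_) (fun i => ?_)).trans
      (by simp)
    · simp only [F₁, coeff_map, ← hs]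
      rw [swap_C]
      exact natDegree_map_le.trans (hxF ▸ natDegree_coeff_le_xDegree F' i)
    · simp only [G₁, coeff_map, ← hs, coe_mapRingHom]
      rw [swap_map_C]
      simp
  · refine (natDegree_resultant_le _ _ _ _ 0 G.natDegree (fun i => ?_) (fun i => ?_)).trans
      (by simp)
    · simp [F₁]
    · simp only [G₁, coeff_map, coe_mapRingHom]
      exact natDegree_map_le.trans (hxG ▸ natDegree_coeff_le_xDegree G' i)
  · intro K _ _ x μ η h1 h2
    obtain ⟨p, q, -, -, h⟩ := exists_mul_add_mul_eq_C_resultant F₁ G₁ hdF hdG (Or.inl hp.ne')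
    set ψ := eval₂RingHom ((aevalAeval μ η : ℂ[X][Y] →ₐ[ℂ] K) : ℂ[X][Y] →+* K) x with hψ
    have hF₁ : ψ F₁ = 0 := by
      rw [← h1, ← aevalAeval_swap]
      refine congrArg (fun f : ℂ[X][Y] →+* K => f F')
        (?_ : ψ.comp (mapRingHom C) = (aevalAeval μ x : ℂ[X][Y] →ₐ[ℂ] K).toRingHom)
      ext <;> simp [hψ]
    have hG₁ : ψ G₁ = 0 := by
      rw [← h2, ← aevalAeval_swap]
      refine congrArg (fun f : ℂ[X][Y] →+* K => f G')
        (?_ : ψ.comp (mapRingHom (mapRingHom C)) = (aevalAeval η x : ℂ[X][Y] →ₐ[ℂ] K).toRingHom)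
      ext <;> simp [hψ]
    have h3 := congrArg ψ h
    rw [map_add, map_mul, map_mul, hF₁, hG₁, zero_mul, zero_mul, zero_add] at h3
    simpa [hψ] using h3.symm
end BivariateDegree

/-! ### Specialization of algebraic functions. -/

/-- Every ring homomorphism to an algebraically closed field extends to integral ring
extensions. -/
theorem exists_ringHom_extension {A B k : Type} [CommRing A] [CommRing B] [Field k] [IsAlgClosed k]
    [Algebra A B] [Algebra.IsIntegral A B] (hinj : Function.Injective (algebraMap A B))
    (ψ : A →+* k) (hψ : Function.Surjective ψ) : ∃ φ : B →+* k, φ.comp (algebraMap A B) = ψ := by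
  have hmax : (RingHom.ker ψ).IsMaximal := RingHom.ker_isMaximal_of_surjective ψ hψ
  -- Lying over: the residue field at Q is integral over k, hence equal to k.
  obtain ⟨Q, hQ, hcomap⟩ := Ideal.exists_ideal_over_maximal_of_isIntegral (S := B) (RingHom.ker ψ)
    (by rw [(RingHom.injective_iff_ker_eq_bot _).1 hinj]; exact bot_le)
  let _ : Field (B ⧸ Q) := Ideal.Quotient.field Q
  set q : B →+* B ⧸ Q := Ideal.Quotient.mk Q with hq
  have hker : ∀ a, ψ a = 0 → q (algebraMap A B a) = 0 := fun a ha => by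
    rw [hq, Ideal.Quotient.eq_zero_iff_mem, ← Ideal.mem_comap, hcomap]; exact ha
  let ρ : k →+* B ⧸ Q :=
    (Ideal.Quotient.lift (RingHom.ker ψ) (q.comp (algebraMap A B)) hker).comp
      (RingHom.quotientKerEquivOfSurjective hψ).symm.toRingHom
  have hρ : ∀ a, ρ (ψ a) = q (algebraMap A B a) := by
    intro a
    have : (RingHom.quotientKerEquivOfSurjective hψ).symm (ψ a) = Ideal.Quotient.mk _ a := by
      rw [RingEquiv.symm_apply_eq]; rfl
    simp only [ρ, RingHom.comp_apply, RingEquiv.toRingHom_eq_coe, RingEquiv.coe_toRingHom, this]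
    rfl
  let _ : Algebra k (B ⧸ Q) := ρ.toAlgebra
  have hint : Algebra.IsIntegral k (B ⧸ Q) := by
    constructor
    intro b
    obtain ⟨b, rfl⟩ := Ideal.Quotient.mk_surjective b
    obtain ⟨p, hp, hpb⟩ := Algebra.IsIntegral.isIntegral (R := A) b
    refine ⟨p.map ψ, hp.map ψ, ?_⟩
    rw [eval₂_map]
    have : (algebraMap k (B ⧸ Q)).comp ψ = q.comp (algebraMap A B) := RingHom.ext hρ
    rw [this, ← hom_eval₂, hpb, map_zero]
  have hbij := IsAlgClosed.algebraMap_bijective_of_isIntegral (k := k) (K := B ⧸ Q)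
  refine ⟨(RingEquiv.ofBijective _ hbij).symm.toRingHom.comp q, ?_⟩
  ext a
  exact (RingEquiv.ofBijective _ hbij).symm_apply_eq.2 (hρ a).symm

theorem algebraMap_X_algFun : algebraMap ℂ[X] AlgFun X = AlgFun.x := by
  rw [IsScalarTower.algebraMap_apply ℂ[X] (RatFunc ℂ) AlgFun, RatFunc.algebraMap_X, AlgFun.x]

theorem algebraMap_C_algFun (c : ℂ) : algebraMap ℂ[X] AlgFun (C c) = algebraMap ℂ AlgFun c := by
  rw [IsScalarTower.algebraMap_apply ℂ ℂ[X] AlgFun]; rfl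

theorem aevalAeval_algFun_x (μ : AlgFun) (P : ℂ[X][Y]) :
    aevalAeval AlgFun.x μ P = (P.map (algebraMap ℂ[X] AlgFun)).eval μ := by
  refine congrArg (fun g : ℂ[X][Y] →+* AlgFun => g P)
    (?_ : (aevalAeval AlgFun.x μ : ℂ[X][Y] →ₐ[ℂ] AlgFun).toRingHom =
      (evalRingHom μ).comp (mapRingHom (algebraMap ℂ[X] AlgFun)))
  ext <;> simp [algebraMap_X_algFun, algebraMap_C_algFun]

/-- Common specializations of algebraic functions at a point `l` of the affine line. -/
theorem exists_specialization {F G : ℂ[X][Y]} (hF : F.Monic) (hG : G.Monic) {l y z : ℂ}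
    (hy : F.evalEval l y = 0) (hz : G.evalEval l z = 0) :
    ∃ μ η : AlgFun, aevalAeval AlgFun.x μ F = 0 ∧ aevalAeval AlgFun.x η G = 0 ∧
      ∀ H : ℂ[X][Y], aevalAeval μ η H = 0 → H.evalEval y z = 0 := by
  have hinj : Function.Injective (algebraMap ℂ[X] AlgFun) := by
    rw [IsScalarTower.algebraMap_eq ℂ[X] (RatFunc ℂ) AlgFun]
    exact (algebraMap (RatFunc ℂ) AlgFun).injective.comp (IsFractionRing.injective _ _)
  let O := integralClosure ℂ[X] AlgFun
  -- A single φ must serve both F and G, so that relations between μ and η specialize.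
  obtain ⟨φ, hφ⟩ := exists_ringHom_extension (A := ℂ[X]) (B := O) (k := ℂ)
    (fun a b h => hinj (congrArg Subtype.val h)) (evalRingHom l)
    (fun c => ⟨C c, by simp⟩)
  have key : ∀ (P : ℂ[X][Y]) (w : ℂ), P.Monic → P.evalEval l w = 0 →
      ∃ o : O, aevalAeval AlgFun.x (o : AlgFun) P = 0 ∧ φ o = w := by
    intro P w hP hw
    set PK := P.map (algebraMap ℂ[X] AlgFun) with hPK
    have hroot : ∀ a ∈ PK.roots, a ∈ O := by
      intro a ha
      refine ⟨P, hP, ?_⟩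
      have := (mem_roots'.1 ha).2
      rwa [IsRoot.def, hPK, eval_map] at this
    obtain ⟨m, hm⟩ : ∃ m : Multiset O, m.map Subtype.val = PK.roots := CanLift.prf _ hroot
    -- A monic P splits over the integral closure; applying φ to the factorization shows that every
    -- root of P(l,·) is the value of some root of P.
    have hfac : P.map (algebraMap ℂ[X] O) = (m.map fun a => X - C a).prod := by
      apply Polynomial.map_injective (algebraMap O AlgFun) Subtype.val_injective
      rw [Polynomial.map_map, ← IsScalarTower.algebraMap_eq, ← hPK,
        (IsAlgClosed.splits PK).eq_prod_roots_of_monic (hP.map _), ← hm, Multiset.map_map,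
        Polynomial.map_multiset_prod, Multiset.map_map]
      congr 1
      refine Multiset.map_congr rfl fun a _ => ?_
      simp
    have h1 : (P.map (evalRingHom l)).eval w = 0 := by rw [map_evalRingHom_eval, hw]
    rw [← hφ, ← Polynomial.map_map, hfac, Polynomial.map_multiset_prod, Multiset.map_map,
      eval_multiset_prod, Multiset.map_map, Multiset.prod_eq_zero_iff] at h1
    obtain ⟨o, ho, h0⟩ := Multiset.mem_map.1 h1
    refine ⟨o, ?_, ?_⟩
    · have := (mem_roots'.1 (hm ▸ Multiset.mem_map_of_mem Subtype.val ho)).2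
      rwa [IsRoot.def, hPK, ← aevalAeval_algFun_x] at this
    · have h2 : w - φ o = 0 := by simpa using h0
      exact (sub_eq_zero.1 h2).symm
  obtain ⟨μ, hμ, rfl⟩ := key F y hF hy
  obtain ⟨η, hη, rfl⟩ := key G z hG hz
  refine ⟨μ, η, hμ, hη, fun H hH => ?_⟩
  have hφC : ∀ c : ℂ, φ (algebraMap ℂ O c) = c := by
    intro c
    have := congrArg (fun f : ℂ[X] →+* ℂ => f (C c)) hφ
    simp only [RingHom.comp_apply, coe_evalRingHom, eval_C] at this
    exact this
  let φ' : O →ₐ[ℂ] ℂ := { φ with commutes' := hφC }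
  have h1 : aevalAeval (A := O) μ η H = 0 := by
    apply Subtype.val_injective
    rw [ZeroMemClass.coe_zero, ← hH]
    refine congrArg (fun f : ℂ[X][Y] →ₐ[ℂ] AlgFun => f H)
      (?_ : (O.val.restrictScalars ℂ).comp (aevalAeval μ η) = aevalAeval (μ : AlgFun) η)
    ext <;> simp
  have h2 := congrArg φ' h1
  rw [map_zero] at h2
  rw [← coe_aevalAeval_eq_evalEval, ← h2]
  refine congrArg (fun f : ℂ[X][Y] →ₐ[ℂ] ℂ => f H)
      (?_ : aevalAeval (φ μ) (φ η) = φ'.comp (aevalAeval μ η))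
  ext <;> simp [φ']

/-! ### Eigenvalues of `f(xI)` and of `f(A)`. -/

section CharacteristicPolynomial
variable {r : ℕ}

/-- The characteristic polynomial of `f(xI)`, with inner variable `x`. -/
def charpolyAtScalar (f : (CMat r)[X]) : ℂ[X][Y] := (matPolyEquiv.symm f).charpoly

theorem charpolyAtScalar_monic (f : (CMat r)[X]) : (charpolyAtScalar f).Monic :=
  Matrix.charpoly_monic _

theorem natDegree_charpolyAtScalar (f : (CMat r)[X]) : (charpolyAtScalar f).natDegree = r := by
  rw [charpolyAtScalar, Matrix.charpoly_natDegree_eq_dim, Fintype.card_fin]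

theorem xDegree_charpolyAtScalar_le (f : (CMat r)[X]) :
    xDegree (charpolyAtScalar f) ≤ r * f.natDegree := by
  have hs : ∀ a : ℂ[X][Y], swap a = (swap (R := ℂ)).toRingEquiv.toRingHom a := fun _ => rfl
  rw [xDegree, charpolyAtScalar, Matrix.charpoly, hs, RingHom.map_det]
  refine (natDegree_det_le _ (fun _ => f.natDegree) fun i j => ?_).trans (by simp)
  have hM : ((matPolyEquiv.symm f) i j).natDegree ≤ f.natDegree := by
    rw [natDegree_le_iff_coeff_eq_zero]
    intro k hk
    rw [matPolyEquiv_symm_apply_coeff, coeff_eq_zero_of_natDegree_lt hk, Matrix.zero_apply]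
  rw [RingHom.mapMatrix_apply, Matrix.map_apply, ← hs, Matrix.charmatrix_apply, map_sub, swap_C]
  refine (natDegree_sub_le _ _).trans (max_le ?_ (natDegree_map_le.trans hM))
  rw [Matrix.diagonal_apply]
  split_ifs
  · rw [swap_Y, natDegree_C]; exact Nat.zero_le _
  · simp

theorem atScalarVariable_eq_map (f : (CMat r)[X]) :
    atScalarVariable f = (matPolyEquiv.symm f).map (algebraMap ℂ[X] AlgFun) := by
  induction f using Polynomial.induction_on' with
  | add p q hp hq =>
    rw [atScalarVariable] at *
    rw [eval₂_add, hp, hq, map_add, Matrix.map_add _ (map_add _)]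
  | monomial n M =>
    rw [atScalarVariable, eval₂_monomial]
    ext i j
    have : (matPolyEquiv.symm (monomial n M)) i j = monomial n (M i j) := by
      ext k
      rw [matPolyEquiv_symm_apply_coeff, coeff_monomial, coeff_monomial]
      split_ifs <;> rfl
    rw [Matrix.map_apply, this, ← C_mul_X_pow_eq_monomial, map_mul, map_pow, algebraMap_X_algFun, algebraMap_C_algFun, ← map_pow,
      Matrix.scalar_apply, Matrix.mul_diagonal]
    rfl

theorem isEigenvalueAtScalarVariable_iff (f : (CMat r)[X]) (μ : AlgFun) :
    IsEigenvalueAtScalarVariable f μ ↔ aevalAeval AlgFun.x μ (charpolyAtScalar f) = 0 := by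
  rw [IsEigenvalueAtScalarVariable, Module.End.hasEigenvalue_iff_isRoot_charpoly,
    Matrix.charpoly_toLin', aevalAeval_algFun_x, IsRoot.def, atScalarVariable_eq_map, charpolyAtScalar,
    ← Matrix.charpoly_map]

/-- Coefficients stand to the left of the powers of A, so the powers reach v first; no commutation
is needed. -/
theorem eval_mulVec_of_eigenvector (f : (CMat r)[X]) {A : CMat r} {l : ℂ} {v : Fin r → ℂ}
    (hv : A.mulVec v = l • v) : (f.eval A).mulVec v = (f.eval (Matrix.scalar (Fin r) l)).mulVec v := by
  have hpow : ∀ n : ℕ, (A ^ n).mulVec v = l ^ n • v := by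
    intro n
    induction n with
    | zero => simp
    | succ n ih => rw [pow_succ, ← Matrix.mulVec_mulVec, hv, Matrix.mulVec_smul, ih, smul_smul,
        pow_succ']
  rw [eval_eq_sum_range, eval_eq_sum_range, Matrix.sum_mulVec, Matrix.sum_mulVec]
  refine Finset.sum_congr rfl fun n _ => ?_
  rw [← Matrix.mulVec_mulVec, hpow, ← Matrix.mulVec_mulVec, ← map_pow]
  congr 1
  simp

/-- Commutation makes the l-eigenspace of A stable under f(A). An eigenvector of f(A) inside it is
also an eigenvector of f(lI), and the power condition makes its eigenvalue a root of unity. -/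
theorem exists_evalEval_charpolyAtScalar_eq_zero (f : (CMat r)[X]) {A : CMat r}
    (hA : ∀ i, Commute A (f.coeff i)) {n : ℕ} (hn : f.eval A ^ n = 1) {l : ℂ}
    (hl : A.charpoly.IsRoot l) :
    ∃ y : ℂ, y ^ n = 1 ∧ (charpolyAtScalar f).evalEval l y = 0 := by
  set E := Module.End.eigenspace (Matrix.toLin' A) l
  have hE : Nontrivial E := by
    rw [Submodule.nontrivial_iff_ne_bot]
    have : Module.End.HasEigenvalue (Matrix.toLin' A) l := by
      rw [Module.End.hasEigenvalue_iff_isRoot_charpoly, Matrix.charpoly_toLin']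
      exact hl
    exact this
  have hcomm : Commute A (f.eval A) := by
    rw [eval_eq_sum_range]
    exact Commute.sum_right _ _ _ fun i _ => (hA i).mul_right ((Commute.refl A).pow_right i)
  have hmaps : ∀ v ∈ E, Matrix.toLin' (f.eval A) v ∈ E := by
    intro v hv
    rw [Module.End.mem_eigenspace_iff] at hv ⊢
    rw [Matrix.toLin'_apply, Matrix.toLin'_apply] at *
    rw [Matrix.mulVec_mulVec, hcomm.eq, ← Matrix.mulVec_mulVec, hv, Matrix.mulVec_smul]
  obtain ⟨y, hy⟩ := Module.End.exists_eigenvalue ((Matrix.toLin' (f.eval A)).restrict hmaps)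
  obtain ⟨⟨v, hvE⟩, hv⟩ := hy.exists_hasEigenvector
  have hv0 : v ≠ 0 := fun h => hv.2 (Subtype.ext h)
  have hvy : (f.eval A).mulVec v = y • v := congrArg Subtype.val (hv.apply_eq_smul)
  have hvl : A.mulVec v = l • v := Module.End.mem_eigenspace_iff.1 hvE
  refine ⟨y, ?_, ?_⟩
  · have hpow : ∀ k : ℕ, (f.eval A ^ k).mulVec v = y ^ k • v := by
      intro k
      induction k with
      | zero => simp
      | succ k ih => rw [pow_succ, ← Matrix.mulVec_mulVec, hvy, Matrix.mulVec_smul, ih, smul_smul,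
          pow_succ']
    have := hpow n
    rw [hn, Matrix.one_mulVec] at this
    by_contra h
    have h2 : (y ^ n - 1) • v = 0 := by rw [sub_smul, one_smul, ← this, sub_self]
    exact (smul_eq_zero.1 h2).elim (fun h3 => h (sub_eq_zero.1 h3)) hv0
  · rw [eval_mulVec_of_eigenvector f hvl, ← matPolyEquiv_symm_map_eval] at hvy
    rw [← map_evalRingHom_eval, charpolyAtScalar, ← Matrix.charpoly_map]
    have : Module.End.HasEigenvalue
        (Matrix.toLin' ((matPolyEquiv.symm f).map (eval l))) y :=
      Module.End.hasEigenvalue_of_hasEigenvector ⟨Module.End.mem_eigenspace_iff.2 hvy, hv0⟩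
    rw [Module.End.hasEigenvalue_iff_isRoot_charpoly, Matrix.charpoly_toLin'] at this
    exact this

end CharacteristicPolynomial

/-! ### Polynomials with prescribed exponents, and their scalings. -/

section Sparse

/-- The bivariate polynomial `∑ c v Y^(m v₁) Z^(m v₂)` over `v ∈ s`. -/
def sparse (m : ℕ) (s : Finset (ℕ × ℕ)) (c : ℕ × ℕ → ℂ) : ℂ[X][Y] :=
  ∑ v ∈ s, monomial (m * v.2) (monomial (m * v.1) (c v))

variable {m : ℕ} {s : Finset (ℕ × ℕ)} {c : ℕ × ℕ → ℂ}

theorem aevalAeval_sparse {K : Type} [CommRing K] [Algebra ℂ K] (μ η : K) :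
    aevalAeval μ η (sparse m s c) =
      ∑ v ∈ s, algebraMap ℂ K (c v) * (μ ^ v.1 * η ^ v.2) ^ m := by
  rw [sparse, map_sum]
  refine Finset.sum_congr rfl fun v _ => ?_
  rw [← C_mul_X_pow_eq_monomial, ← C_mul_X_pow_eq_monomial]
  simp only [map_mul, map_pow, aevalAeval_Y, aevalAeval_C, aeval_X, aeval_C]
  rw [mul_pow, ← pow_mul, ← pow_mul, mul_comm m, mul_comm m, mul_assoc]

theorem evalEval_sparse (y z : ℂ) :
    (sparse m s c).evalEval y z = ∑ v ∈ s, c v * (y ^ v.1 * z ^ v.2) ^ m := by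
  rw [← coe_aevalAeval_eq_evalEval, aevalAeval_sparse]
  rfl

theorem coeff_coeff_sparse (hm : 0 < m) {v : ℕ × ℕ} (hv : v ∈ s) :
    ((sparse m s c).coeff (m * v.2)).coeff (m * v.1) = c v := by
  rw [sparse, finsetSum_coeff, finsetSum_coeff, Finset.sum_eq_single v]
  · simp
  · intro w _ hw
    simp only [coeff_monomial]
    split_ifs with h1
    · rw [coeff_monomial, if_neg]
      intro h2
      exact hw (Prod.ext (Nat.eq_of_mul_eq_mul_left hm h2) (Nat.eq_of_mul_eq_mul_left hm h1))
    · simp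
  · exact fun h => absurd hv h

theorem sparse_ne_zero (hm : 0 < m) {v : ℕ × ℕ} (hv : v ∈ s) (hc : c v ≠ 0) : sparse m s c ≠ 0 := by
  intro h
  have := coeff_coeff_sparse (c := c) hm hv
  rw [h] at this
  simp at this
  exact hc this.symm

theorem natDegree_sparse_le : (sparse m s c).natDegree ≤ m * s.sup Prod.snd :=
  natDegree_sum_le_of_forall_le _ _ fun _ hv => (natDegree_monomial_le _).trans
    (Nat.mul_le_mul_left _ (Finset.le_sup (f := Prod.snd) hv))

theorem xDegree_sparse_le : xDegree (sparse m s c) ≤ m * s.sup Prod.fst := by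
  rw [xDegree, sparse, map_sum]
  refine natDegree_sum_le_of_forall_le _ _ fun v hv => ?_
  rw [swap_monomial_monomial]
  exact (natDegree_monomial_le _).trans (Nat.mul_le_mul_left _ (Finset.le_sup (f := Prod.fst) hv))

theorem natDegree_sparse_one (hc : ∀ v ∈ s, c v ≠ 0) :
    (sparse 1 s c).natDegree = s.sup Prod.snd := by
  refine le_antisymm (natDegree_sparse_le.trans (one_mul _).le) (Finset.sup_le fun v hv => ?_)
  refine le_natDegree_of_ne_zero fun h => hc v hv ?_
  rw [← coeff_coeff_sparse (m := 1) (c := c) one_pos hv, one_mul, one_mul, h, coeff_zero]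

theorem xDegree_sparse_one (hc : ∀ v ∈ s, c v ≠ 0) : xDegree (sparse 1 s c) = s.sup Prod.fst := by
  refine le_antisymm (xDegree_sparse_le.trans (one_mul _).le) (Finset.sup_le fun v hv => ?_)
  refine (le_natDegree_of_ne_zero fun h => hc v hv ?_).trans
    (natDegree_coeff_le_xDegree (sparse 1 s c) v.2)
  rw [← coeff_coeff_sparse (m := 1) (c := c) one_pos hv, one_mul, one_mul, h]

theorem sparse_const_mul (d : ℂ) : sparse m s (fun v => d * c v) = C (C d) * sparse m s c := by
  rw [sparse, sparse, Finset.mul_sum]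
  simp [C_mul_monomial]

theorem eq_C_C_of_degrees_eq_zero {D : ℂ[X][Y]} (h1 : D.natDegree = 0) (h2 : xDegree D = 0) :
    ∃ d, D = C (C d) := by
  have h3 := natDegree_coeff_le_xDegree D 0
  rw [h2] at h3
  refine ⟨(D.coeff 0).coeff 0, ?_⟩
  rw [← eq_C_of_natDegree_eq_zero (Nat.le_zero.1 h3), ← eq_C_of_natDegree_eq_zero h1]

/-- The divisor already has the largest bidegree that s allows, so the quotient is a constant, and
the normalization at v₀ makes it 1. This is how every non-divisibility except that for squared
variables is proved. -/
theorem eq_of_sparse_dvd_sparse {c' : ℕ × ℕ → ℂ} (hc : ∀ v ∈ s, c v ≠ 0) {v₀ : ℕ × ℕ}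
    (hv₀ : v₀ ∈ s) (h0 : c v₀ = 1) (h0' : c' v₀ = 1) (h : sparse 1 s c ∣ sparse 1 s c') :
    ∀ v ∈ s, c v = c' v := by
  have hQ : sparse 1 s c' ≠ 0 := sparse_ne_zero one_pos hv₀ (by rw [h0']; exact one_ne_zero)
  obtain ⟨D, hD⟩ := h
  have hP0 : sparse 1 s c ≠ 0 := left_ne_zero_of_mul (hD ▸ hQ)
  have hD0 : D ≠ 0 := right_ne_zero_of_mul (hD ▸ hQ)
  have h1 : (sparse 1 s c').natDegree ≤ _ := natDegree_sparse_le
  have h2 : xDegree (sparse 1 s c') ≤ _ := xDegree_sparse_le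
  rw [hD, natDegree_mul hP0 hD0, natDegree_sparse_one hc] at h1
  rw [hD, xDegree_mul hP0 hD0, xDegree_sparse_one hc] at h2
  obtain ⟨d, rfl⟩ := eq_C_C_of_degrees_eq_zero (D := D) (by omega) (by omega)
  have key : ∀ v ∈ s, c' v = c v * d := by
    intro v hv
    rw [← coeff_coeff_sparse (m := 1) (c := c') one_pos hv, hD, coeff_mul_C, coeff_mul_C,
      coeff_coeff_sparse one_pos hv]
  have hd : d = 1 := by simpa [h0, h0'] using (key v₀ hv₀).symm
  intro v hv
  rw [key v hv, hd, mul_one]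

theorem exists_finset_fst_of_sparse_not_dvd {c' : ℕ × ℕ → ℂ} (hc : ∀ v ∈ s, c v ≠ 0)
    (hP : Irreducible (sparse 1 s c)) (hs : 0 < s.sup Prod.snd)
    (h : ¬ sparse 1 s c ∣ sparse m s c') :
    ∃ T : Finset ℂ, T.card ≤ 2 * m * (s.sup Prod.fst * s.sup Prod.snd) ∧
      ∀ y z, (sparse 1 s c).evalEval y z = 0 → (sparse m s c').evalEval y z = 0 → y ∈ T := by
  obtain ⟨T, hT, h⟩ := exists_finset_fst_of_not_dvd hP (by rwa [natDegree_sparse_one hc]) h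
    xDegree_sparse_le natDegree_sparse_le
  refine ⟨T, hT.trans (le_of_eq ?_), h⟩
  rw [natDegree_sparse_one hc, xDegree_sparse_one hc]
  ring

theorem scale_comp_scale {g h g' h' : ℂ} (hg : g * g' = 1) (hh : h * h' = 1) :
    (aevalAeval (C (C g * X)) (C (C h) * Y) : ℂ[X][Y] →ₐ[ℂ] ℂ[X][Y]).comp
      (aevalAeval (C (C g' * X)) (C (C h') * Y)) = AlgHom.id ℂ _ := by
  apply (aevalAevalEquiv ℂ _).symm.injective
  simp only [aevalAevalEquiv_symm_apply, AlgHom.comp_apply, aevalAeval_Y, map_mul,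
    aevalAeval_C, aeval_C, aeval_X, AlgHom.id_apply, coe_algebraMap_eq_CC, ← mul_assoc]
  simp only [← map_mul, mul_comm g', mul_comm h', hg, hh, map_one, one_mul]

/-- The automorphism `Y ↦ g Y`, `Z ↦ h Z`. -/
def scaleEquiv (g h : ℂˣ) : ℂ[X][Y] ≃ₐ[ℂ] ℂ[X][Y] :=
  AlgEquiv.ofAlgHom (aevalAeval (C (C (g : ℂ) * X)) (C (C (h : ℂ)) * Y))
    (aevalAeval (C (C (↑g⁻¹ : ℂ) * X)) (C (C (↑h⁻¹ : ℂ)) * Y))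
    (scale_comp_scale g.mul_inv h.mul_inv) (scale_comp_scale g.inv_mul h.inv_mul)

theorem scaleEquiv_sparse (g h : ℂˣ) : scaleEquiv g h (sparse m s c) =
    sparse m s fun v => c v * ((g : ℂ) ^ v.1 * (h : ℂ) ^ v.2) ^ m := by
  change aevalAeval _ _ _ = _
  rw [aevalAeval_sparse, sparse]
  refine Finset.sum_congr rfl fun v _ => ?_
  rw [← C_mul_X_pow_eq_monomial, ← C_mul_X_pow_eq_monomial, coe_algebraMap_eq_CC]
  simp only [map_mul, map_pow, mul_pow, ← pow_mul]
  simp only [mul_comm m]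
  ring

end Sparse

/-! ### Characters of the exponent lattice. -/

/-- Cramer's rule in multiplicative form, applied to roots of α and β of order the determinant. It
realizes a character of the lattice by a point of the torus. -/
theorem exists_scaled_roots {u w : ℤ × ℤ} (hD : u.1 * w.2 - u.2 * w.1 ≠ 0) (α β : ℂˣ) :
    ∃ g h : ℂˣ, g ^ u.1 * h ^ u.2 = α ∧ g ^ w.1 * h ^ w.2 = β ∧
      (IsOfFinOrder α → IsOfFinOrder β → IsOfFinOrder g ∧ IsOfFinOrder h) := by
  have hroot : ∀ a : ℂˣ, ∃ a₀ : ℂˣ, a₀ ^ (u.1 * w.2 - u.2 * w.1) = a := by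
    intro a
    set D := u.1 * w.2 - u.2 * w.1
    have hD' : 0 < D.natAbs := Int.natAbs_pos.2 hD
    obtain ⟨x, hx⟩ := IsAlgClosed.exists_pow_nat_eq (a : ℂ) hD'
    have hx0 : x ≠ 0 := by
      rintro rfl
      rw [zero_pow hD'.ne'] at hx
      exact a.ne_zero hx.symm
    have h1 : Units.mk0 x hx0 ^ D.natAbs = a := Units.ext hx
    rcases Int.natAbs_eq D with h | h
    · exact ⟨Units.mk0 x hx0, by rw [h, zpow_natCast, h1]⟩
    · exact ⟨(Units.mk0 x hx0)⁻¹, by rw [h, zpow_neg, zpow_natCast, inv_pow, h1, inv_inv]⟩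
  obtain ⟨α₀, hα⟩ := hroot α
  obtain ⟨β₀, hβ⟩ := hroot β
  refine ⟨α₀ ^ w.2 * β₀ ^ (-u.2), α₀ ^ (-w.1) * β₀ ^ u.1, ?_, ?_, fun h1 h2 => ?_⟩
  · rw [mul_zpow, mul_zpow, ← zpow_mul, ← zpow_mul, ← zpow_mul, ← zpow_mul, mul_mul_mul_comm,
      ← zpow_add, ← zpow_add, ← hα,
      show w.2 * u.1 + -w.1 * u.2 = u.1 * w.2 - u.2 * w.1 by ring,
      show -u.2 * u.1 + u.1 * u.2 = 0 by ring, zpow_zero, mul_one]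
  · rw [mul_zpow, mul_zpow, ← zpow_mul, ← zpow_mul, ← zpow_mul, ← zpow_mul, mul_mul_mul_comm,
      ← zpow_add, ← zpow_add, ← hβ, show w.2 * w.1 + -w.1 * w.2 = 0 by ring,
      show -u.2 * w.1 + u.1 * w.2 = u.1 * w.2 - u.2 * w.1 by ring, zpow_zero, one_mul]
  · have hfin : ∀ a b : ℂˣ, IsOfFinOrder b → a ^ (u.1 * w.2 - u.2 * w.1) = b → IsOfFinOrder a := by
      rintro a b hb rfl
      obtain ⟨n, hn, hbn⟩ := isOfFinOrder_iff_pow_eq_one.1 hb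
      refine isOfFinOrder_iff_zpow_eq_one.2 ⟨(u.1 * w.2 - u.2 * w.1) * n, ?_, ?_⟩
      · exact mul_ne_zero hD (by exact_mod_cast hn.ne')
      · rw [zpow_mul, zpow_natCast, hbn]
    have h1' := hfin _ _ h1 hα
    have h2' := hfin _ _ h2 hβ
    exact ⟨h1'.zpow.mul h2'.zpow, h1'.zpow.mul h2'.zpow⟩

/-- A basis `u, w` of the rank two lattice generated by the differences of the exponents in `s`,
with the coordinates `n₁ v, n₂ v` of `v - base`. -/
structure LatticeChart (s : Finset (ℕ × ℕ)) where
  base : ℕ × ℕ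
  base_mem : base ∈ s
  u : ℤ × ℤ
  w : ℤ × ℤ
  det_ne : u.1 * w.2 - u.2 * w.1 ≠ 0
  n₁ : ℕ × ℕ → ℤ
  n₂ : ℕ × ℕ → ℤ
  fst_eq : ∀ v ∈ s, (v.1 : ℤ) = base.1 + (n₁ v * u.1 + n₂ v * w.1)
  snd_eq : ∀ v ∈ s, (v.2 : ℤ) = base.2 + (n₁ v * u.2 + n₂ v * w.2)
  primitive : ∀ ε : ℤˣ × ℤˣ, (∀ v ∈ s, ε.1 ^ n₁ v * ε.2 ^ n₂ v = 1) → ε = 1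

namespace LatticeChart
variable {s : Finset (ℕ × ℕ)} (χ : LatticeChart s)

theorem n_base : χ.n₁ χ.base = 0 ∧ χ.n₂ χ.base = 0 := by
  have h1 : χ.n₁ χ.base * χ.u.1 + χ.n₂ χ.base * χ.w.1 = 0 := by
    linarith [χ.fst_eq _ χ.base_mem]
  have h2 : χ.n₁ χ.base * χ.u.2 + χ.n₂ χ.base * χ.w.2 = 0 := by
    linarith [χ.snd_eq _ χ.base_mem]
  constructor
  · refine (mul_eq_zero.1 (?_ : χ.n₁ χ.base * (χ.u.1 * χ.w.2 - χ.u.2 * χ.w.1) = 0)).resolve_right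
      χ.det_ne
    linear_combination χ.w.2 * h1 - χ.w.1 * h2
  · refine (mul_eq_zero.1 (?_ : χ.n₂ χ.base * (χ.u.1 * χ.w.2 - χ.u.2 * χ.w.1) = 0)).resolve_right
      χ.det_ne
    linear_combination χ.u.1 * h2 - χ.u.2 * h1

/-- The character of the lattice with values `α, β` at the basis, at `v - base`. -/
def char (α β : ℂˣ) (v : ℕ × ℕ) : ℂˣ := α ^ χ.n₁ v * β ^ χ.n₂ v

@[simp] theorem char_base (α β : ℂˣ) : χ.char α β χ.base = 1 := by
  simp [char, χ.n_base.1, χ.n_base.2]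

theorem char_mul (α β α' β' : ℂˣ) (v : ℕ × ℕ) :
    χ.char (α * α') (β * β') v = χ.char α β v * χ.char α' β' v := by
  simp only [char, mul_zpow]
  exact mul_mul_mul_comm _ _ _ _

theorem char_pow (α β : ℂˣ) (k : ℕ) (v : ℕ × ℕ) : χ.char (α ^ k) (β ^ k) v = χ.char α β v ^ k := by
  simp only [char, ← zpow_natCast, ← zpow_mul, mul_zpow, mul_comm (k : ℤ)]

/-- The inclusion of the signs in the complex numbers. -/
def signUnit : ℤˣ →* ℂˣ := Units.map (Int.castRingHom ℂ)

theorem signUnit_injective : Function.Injective signUnit :=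
  Units.map_injective Int.cast_injective

theorem signUnit_sq (e : ℤˣ) : signUnit e ^ 2 = 1 := by
  rw [← map_pow, Int.units_sq, map_one]

theorem exists_signUnit_of_sq_eq_one {x : ℂˣ} (h : x ^ 2 = 1) : ∃ e : ℤˣ, x = signUnit e := by
  have h' : (x : ℂ) ^ 2 = 1 := by rw [← Units.val_pow_eq_pow_val, h, Units.val_one]
  rcases mul_self_eq_one_iff.1 ((sq _).symm.trans h') with h1 | h1
  · exact ⟨1, by rw [map_one]; exact Units.ext h1⟩
  · exact ⟨-1, Units.ext (by simp [signUnit, h1])⟩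

/-- The quadratic character of the lattice with values `ε` at the basis, at `v - base`. -/
def sign (ε : ℤˣ × ℤˣ) (v : ℕ × ℕ) : ℂˣ := χ.char (signUnit ε.1) (signUnit ε.2) v

@[simp] theorem sign_base (ε : ℤˣ × ℤˣ) : χ.sign ε χ.base = 1 := χ.char_base _ _

theorem sign_sq (ε : ℤˣ × ℤˣ) (v : ℕ × ℕ) : χ.sign ε v ^ 2 = 1 := by
  rw [sign, ← char_pow, signUnit_sq, signUnit_sq]
  simp [char]

theorem sign_eq_imp {ε ε' : ℤˣ × ℤˣ} (h : ∀ v ∈ s, χ.sign ε v = χ.sign ε' v) : ε = ε' := by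
  have : ε * ε'⁻¹ = 1 := by
    refine χ.primitive _ fun v hv => signUnit_injective ?_
    have := h v hv
    simp only [sign, char, ← map_zpow, ← map_mul] at this
    have h2 := signUnit_injective this
    simp only [Prod.fst_mul, Prod.snd_mul, Prod.fst_inv, Prod.snd_inv, mul_zpow, inv_zpow]
    rw [mul_mul_mul_comm, h2, ← mul_inv, mul_inv_cancel]
  rwa [mul_inv_eq_one] at this

/-- Monomials in a torus point, through the chart. -/
theorem monomial_eq {g h : ℂˣ} {v : ℕ × ℕ} (hv : v ∈ s) :
    g ^ v.1 * h ^ v.2 = g ^ χ.base.1 * h ^ χ.base.2 *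
      χ.char (g ^ χ.u.1 * h ^ χ.u.2) (g ^ χ.w.1 * h ^ χ.w.2) v := by
  rw [← zpow_natCast g v.1, ← zpow_natCast h v.2, χ.fst_eq v hv, χ.snd_eq v hv]
  simp only [char, zpow_add, mul_zpow, zpow_natCast, ← zpow_mul, mul_comm (χ.n₁ v),
    mul_comm (χ.n₂ v)]
  simp only [mul_assoc, mul_left_comm]

/-- After division by the monomial at the base, vanishing depends only on the character values α, β
on the basis of the lattice. -/
theorem evalEval_sparse_eq_zero_iff (g h : ℂˣ) (m : ℕ) (c : ℕ × ℕ → ℂ) :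
    (sparse m s c).evalEval (g : ℂ) (h : ℂ) = 0 ↔
      ∑ v ∈ s, c v * (χ.char (g ^ χ.u.1 * h ^ χ.u.2) (g ^ χ.w.1 * h ^ χ.w.2) v : ℂ) ^ m = 0 := by
  have : (sparse m s c).evalEval (g : ℂ) (h : ℂ) = ((g ^ χ.base.1 * h ^ χ.base.2 : ℂˣ) : ℂ) ^ m *
      ∑ v ∈ s, c v * (χ.char (g ^ χ.u.1 * h ^ χ.u.2) (g ^ χ.w.1 * h ^ χ.w.2) v : ℂ) ^ m := by
    rw [evalEval_sparse, Finset.mul_sum]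
    refine Finset.sum_congr rfl fun v hv => ?_
    have := congrArg Units.val (χ.monomial_eq (g := g) (h := h) hv)
    simp only [Units.val_mul, Units.val_pow_eq_pow_val] at this ⊢
    rw [this, mul_pow]
    ring
  rw [this, mul_eq_zero, or_iff_right (pow_ne_zero _ (Units.ne_zero _))]

/-- Twisting coefficients by a character of the lattice amounts to an automorphism of the
polynomial ring. -/
theorem exists_algEquiv_sparse (α β : ℂˣ) : ∃ (e : ℂ[X][Y] ≃ₐ[ℂ] ℂ[X][Y]) (d : ℂˣ),
    ∀ (m : ℕ) (c : ℕ × ℕ → ℂ), e (sparse m s c) =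
      C (C ((d : ℂ) ^ m)) * sparse m s fun v => c v * (χ.char α β v : ℂ) ^ m := by
  obtain ⟨g, h, hg, hh, -⟩ := exists_scaled_roots χ.det_ne α β
  refine ⟨scaleEquiv g h, g ^ χ.base.1 * h ^ χ.base.2, fun m c => ?_⟩
  rw [scaleEquiv_sparse, ← sparse_const_mul, sparse, sparse]
  refine Finset.sum_congr rfl fun v hv => ?_
  have := congrArg Units.val (χ.monomial_eq (g := g) (h := h) hv)
  rw [hg, hh] at this
  simp only [Units.val_mul, Units.val_pow_eq_pow_val] at this ⊢
  rw [this, mul_pow]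
  ring_nf

theorem isUnit_C_C_pow (d : ℂˣ) (m : ℕ) : IsUnit (C (C ((d : ℂ) ^ m)) : ℂ[X][Y]) :=
  isUnit_C.2 (isUnit_C.2 (d.isUnit.pow m))

theorem irreducible_twist {c : ℕ × ℕ → ℂ} (hP : Irreducible (sparse 1 s c)) (α β : ℂˣ) :
    Irreducible (sparse 1 s fun v => c v * (χ.char α β v : ℂ)) := by
  obtain ⟨e, d, h⟩ := χ.exists_algEquiv_sparse α β
  have h1 := (MulEquiv.irreducible_iff e.toMulEquiv).2 hP
  change Irreducible (e (sparse 1 s c)) at h1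
  rw [h, irreducible_isUnit_mul (isUnit_C_C_pow d 1)] at h1
  simpa using h1

theorem twist_dvd_twist {c c' : ℕ × ℕ → ℂ} {m : ℕ} (hP : sparse 1 s c ∣ sparse m s c')
    (α β : ℂˣ) : (sparse 1 s fun v => c v * (χ.char α β v : ℂ)) ∣
      sparse m s fun v => c' v * (χ.char α β v : ℂ) ^ m := by
  obtain ⟨e, d, h⟩ := χ.exists_algEquiv_sparse α β
  have h1 := map_dvd e hP
  rw [h, h, (isUnit_C_C_pow d 1).mul_left_dvd, (isUnit_C_C_pow d m).dvd_mul_left] at h1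
  simpa using h1

/-- An irreducible polynomial does not divide polynomials in `Y ^ 2, Z ^ 2` of twice its degrees. -/
theorem not_dvd_sparse_two {c c' : ℕ × ℕ → ℂ} (hc : ∀ v ∈ s, c v ≠ 0) (h0 : c χ.base = 1)
    (hP : Irreducible (sparse 1 s c)) (hs : 0 < s.sup Prod.snd) (h0' : c' χ.base ≠ 0) :
    ¬ sparse 1 s c ∣ sparse 2 s c' := by
  intro hdvd
  -- Squaring absorbs signs, so all four sign twists would divide. They are irreducible and pairwise
  -- coprime by primitivity of the chart, so their product has four times the degree where only
  -- twice is available.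
  let P : ℤˣ × ℤˣ → ℂ[X][Y] := fun ε => sparse 1 s fun v => c v * (χ.sign ε v : ℂ)
  have hne : ∀ ε, ∀ v ∈ s, c v * (χ.sign ε v : ℂ) ≠ 0 := fun ε v hv =>
    mul_ne_zero (hc v hv) (Units.ne_zero _)
  have hirr : ∀ ε, Irreducible (P ε) := fun ε => χ.irreducible_twist hP _ _
  have hQ : ∀ ε, P ε ∣ sparse 2 s c' := by
    intro ε
    have h2 : (fun v => c' v * (χ.sign ε v : ℂ) ^ 2) = c' := by
      funext v
      rw [← Units.val_pow_eq_pow_val, χ.sign_sq, Units.val_one, mul_one]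
    have := χ.twist_dvd_twist hdvd (signUnit ε.1) (signUnit ε.2)
    change P ε ∣ sparse 2 s fun v => c' v * (χ.sign ε v : ℂ) ^ 2 at this
    rwa [h2] at this
  have hcop : ∀ ε ε', ε ≠ ε' → IsRelPrime (P ε) (P ε') := by
    intro ε ε' hne'
    refine (hirr ε).isRelPrime_iff_not_dvd.2 fun h => hne' (χ.sign_eq_imp fun v hv => ?_)
    have := eq_of_sparse_dvd_sparse (hne ε) χ.base_mem (by simp [h0]) (by simp [h0]) h v hv
    exact Units.ext (mul_left_cancel₀ (hc v hv) this)
  have hprod : ∏ ε, P ε ∣ sparse 2 s c' :=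
    Fintype.prod_dvd_of_isRelPrime (fun ε ε' h => hcop ε ε' h) hQ
  have hQ0 : sparse 2 s c' ≠ 0 := sparse_ne_zero two_pos χ.base_mem h0'
  have h1 := natDegree_le_of_dvd hprod hQ0
  rw [natDegree_prod _ _ fun ε _ => (hirr ε).ne_zero] at h1
  have h2 : (sparse 2 s c').natDegree ≤ _ := natDegree_sparse_le
  simp only [P, natDegree_sparse_one (hne _)] at h1
  have h4 : Fintype.card (ℤˣ × ℤˣ) = 4 := rfl
  rw [Finset.sum_const, Finset.card_univ, h4, smul_eq_mul] at h1
  omega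

end LatticeChart

/-! ### Torsion points over cyclotomic fields. -/

/-- Galois conjugation of a relation between roots of unity. -/
theorem sum_aeval_pow_of_coprime {ι : Type*} (s : Finset ι) (p : ι → ℚ[X]) (θ : ι → ℂ) (ξ : ℂ)
    {n k : ℕ} (hn : 0 < n) (hk : k.Coprime n) (hξ : ξ ^ n = 1) (hθ : ∀ i ∈ s, θ i ^ n = 1)
    (h : ∑ i ∈ s, aeval ξ (p i) * θ i = 0) : ∑ i ∈ s, aeval (ξ ^ k) (p i) * θ i ^ k = 0 := by
  have hn' : NeZero n := ⟨hn.ne'⟩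
  have hζ := Complex.isPrimitiveRoot_exp n hn.ne'
  set ζ := Complex.exp (2 * Real.pi * Complex.I / n)
  obtain ⟨t, -, rfl⟩ := hζ.eq_pow_of_pow_eq_one hξ
  have hθ' : ∀ i, ∃ e : ℕ, i ∈ s → ζ ^ e = θ i := by
    intro i
    by_cases hi : i ∈ s
    · obtain ⟨e, -, he⟩ := hζ.eq_pow_of_pow_eq_one (hθ i hi)
      exact ⟨e, fun _ => he⟩
    · exact ⟨0, fun h => absurd h hi⟩
  choose e he using hθ'
  -- The relation becomes one rational polynomial vanishing at a primitive n-th root ζ; it then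
  -- vanishes at ζ^k, which has the same minimal polynomial.
  set Φ : ℚ[X] := ∑ i ∈ s, (p i).comp (X ^ t) * X ^ e i
  have hΦ : ∀ x : ℂ, aeval x Φ = ∑ i ∈ s, aeval (x ^ t) (p i) * x ^ e i := by
    intro x
    simp [Φ, aeval_comp]
  have h0 : aeval ζ Φ = 0 := by
    rw [hΦ, ← h]
    exact Finset.sum_congr rfl fun i hi => by rw [he i hi]
  have hmin : minpoly ℚ ζ = minpoly ℚ (ζ ^ k) := by
    rw [← cyclotomic_eq_minpoly_rat hζ hn,
      ← cyclotomic_eq_minpoly_rat (hζ.pow_of_coprime k hk) hn]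
  have h1 : aeval (ζ ^ k) Φ = 0 := by
    rw [← minpoly.dvd_iff, ← hmin, minpoly.dvd_iff, h0]
  rw [hΦ] at h1
  rw [← h1]
  refine Finset.sum_congr rfl fun i hi => ?_
  rw [← he i hi, ← pow_mul, ← pow_mul, ← pow_mul, ← pow_mul, mul_comm t, mul_comm (e i)]

namespace LatticeChart
variable {s : Finset (ℕ × ℕ)} (χ : LatticeChart s)

/-- Conjugation by `x ↦ x ^ (j + h)` on roots of unity of order dividing `2 * h` is, up to signs,
raising to the power `j`. -/
theorem exists_sign_sum_eq_zero {p : ℕ × ℕ → ℚ[X]} {ξ : ℂ} {α β : ℂˣ} {h j : ℕ} (hh : 0 < h)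
    (hcop : (j + h).Coprime (2 * h)) (hξ : ξ ^ (2 * h) = 1) (hα : α ^ (2 * h) = 1)
    (hβ : β ^ (2 * h) = 1) (h0 : ∑ v ∈ s, aeval ξ (p v) * (χ.char α β v : ℂ) = 0) :
    ∃ ε : ℤˣ × ℤˣ, α ^ h = signUnit ε.1 ∧ β ^ h = signUnit ε.2 ∧
      ∑ v ∈ s, aeval (ξ ^ (j + h)) (p v) * (χ.sign ε v : ℂ) * (χ.char α β v : ℂ) ^ j = 0 := by
  obtain ⟨ε₁, h1⟩ := exists_signUnit_of_sq_eq_one (x := α ^ h) (by rw [← pow_mul, mul_comm, hα])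
  obtain ⟨ε₂, h2⟩ := exists_signUnit_of_sq_eq_one (x := β ^ h) (by rw [← pow_mul, mul_comm, hβ])
  refine ⟨(ε₁, ε₂), h1, h2, ?_⟩
  have key := sum_aeval_pow_of_coprime s p (fun v => (χ.char α β v : ℂ)) ξ (by omega) hcop hξ
    (fun v _ => by
      rw [← Units.val_pow_eq_pow_val, ← χ.char_pow, hα, hβ]; simp [char]) h0
  rw [← key]
  refine Finset.sum_congr rfl fun v _ => ?_
  have : χ.char α β v ^ (j + h) = χ.sign (ε₁, ε₂) v * χ.char α β v ^ j := by
    rw [pow_add, ← χ.char_pow α β h, h1, h2, mul_comm]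
    rfl
  rw [← Units.val_pow_eq_pow_val _ (j + h), this, Units.val_mul, Units.val_pow_eq_pow_val, mul_assoc]

theorem exists_common_order {α β : ℂˣ} (hα : IsOfFinOrder α) (hβ : IsOfFinOrder β) :
    ∃ m : ℕ, 0 < m ∧ ∀ j, (α ^ j = 1 ∧ β ^ j = 1) ↔ m ∣ j := by
  refine ⟨Nat.lcm (orderOf α) (orderOf β), Nat.lcm_pos hα.orderOf_pos hβ.orderOf_pos, fun j => ?_⟩
  rw [Nat.lcm_dvd_iff, orderOf_dvd_iff_pow_eq_one, orderOf_dvd_iff_pow_eq_one]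

/-- The parity of h decides whether 1 + h or 2 + h is an admissible Galois exponent modulo 2h; the
case distinctions modulo 4 come from this. -/
theorem coprime_one_add_two_mul {h : ℕ} (hh : Even h) : (1 + h).Coprime (2 * h) := by
  refine Nat.Coprime.mul_right ?_ (by simp)
  rw [Nat.coprime_two_right]
  exact hh.one_add

theorem coprime_two_add_two_mul {h : ℕ} (hh : Odd h) : (2 + h).Coprime (2 * h) := by
  refine Nat.Coprime.mul_right ?_ ?_
  · rw [Nat.coprime_two_right]
    exact Even.add_odd even_two hh
  · simpa using hh

/-- Torsion points on a plane curve with coefficients in a cyclotomic field of odd conductor. -/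
theorem exists_torsion_finset_of_odd (hs : 0 < s.sup Prod.snd) {c : ℕ × ℕ → ℂ}
    (hc : ∀ v ∈ s, c v ≠ 0) (h0 : c χ.base = 1) (hP : Irreducible (sparse 1 s c)) {ξ : ℂ} {N : ℕ}
    (hN : Odd N) (hξ : ξ ^ N = 1) (p : ℕ × ℕ → ℚ[X]) (hp : ∀ v ∈ s, c v = aeval ξ (p v))
    (hp0 : p χ.base = 1) :
    ∃ T : Finset ℂ, T.card ≤ 22 * (s.sup Prod.fst * s.sup Prod.snd) ∧
      ∀ g h : ℂˣ, IsOfFinOrder g → IsOfFinOrder h → (sparse 1 s c).evalEval (g : ℂ) (h : ℂ) = 0 →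
        (g : ℂ) ∈ T := by
  classical
  set AB := s.sup Prod.fst * s.sup Prod.snd
  have h1 : ∀ ε : ℤˣ × ℤˣ, ∃ T : Finset ℂ, T.card ≤ 2 * 1 * AB ∧ (ε ≠ 1 →
      ∀ y z, (sparse 1 s c).evalEval y z = 0 →
        (sparse 1 s fun v => c v * (χ.sign ε v : ℂ)).evalEval y z = 0 → y ∈ T) := by
    intro ε
    by_cases hε : ε = 1
    · exact ⟨∅, by simp, fun h => absurd hε h⟩
    · have hnd : ¬ sparse 1 s c ∣ sparse 1 s fun v => c v * (χ.sign ε v : ℂ) := by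
        intro hd
        refine hε (χ.sign_eq_imp fun v hv => Units.ext (mul_left_cancel₀ (hc v hv) ?_))
        rw [← eq_of_sparse_dvd_sparse hc χ.base_mem h0 (by simp [h0]) hd v hv]
        simp [sign, char]
      obtain ⟨T, hT, hT'⟩ := exists_finset_fst_of_sparse_not_dvd hc hP hs hnd
      exact ⟨T, hT, fun _ => hT'⟩
  have h2 : ∀ ε : ℤˣ × ℤˣ, ∃ T : Finset ℂ, T.card ≤ 2 * 2 * AB ∧
      ∀ y z, (sparse 1 s c).evalEval y z = 0 →
        (sparse 2 s fun v => aeval (ξ ^ 2) (p v) * (χ.sign ε v : ℂ)).evalEval y z = 0 → y ∈ T :=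
    fun ε => exists_finset_fst_of_sparse_not_dvd hc hP hs
      (χ.not_dvd_sparse_two hc h0 hP hs (by simp [hp0]))
  choose T₁ hT₁ hT₁' using h1
  choose T₂ hT₂ hT₂' using h2
  -- Three nontrivial sign twists at 2AB each and four twists in squared variables at 4AB each: 6 +
  -- 16 = 22.
  refine ⟨(Finset.univ.erase 1).biUnion T₁ ∪ Finset.univ.biUnion T₂, ?_, ?_⟩
  · have e1 := Finset.card_biUnion_le_card_mul (Finset.univ.erase (1 : ℤˣ × ℤˣ)) T₁ _
      fun ε _ => hT₁ ε
    have e2 := Finset.card_biUnion_le_card_mul (Finset.univ : Finset (ℤˣ × ℤˣ)) T₂ _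
      fun ε _ => hT₂ ε
    have h4 : (Finset.univ : Finset (ℤˣ × ℤˣ)).card = 4 := rfl
    rw [Finset.card_erase_of_mem (Finset.mem_univ _), h4] at e1
    rw [h4] at e2
    have := Finset.card_union_le ((Finset.univ.erase (1 : ℤˣ × ℤˣ)).biUnion T₁)
      (Finset.univ.biUnion T₂)
    omega
  · intro g h hg hh hgh
    have hgh' := (χ.evalEval_sparse_eq_zero_iff g h 1 c).1 hgh
    set α := g ^ χ.u.1 * h ^ χ.u.2 with hα
    set β := g ^ χ.w.1 * h ^ χ.w.2 with hβ
    have hrel : ∑ v ∈ s, aeval ξ (p v) * (χ.char α β v : ℂ) = 0 := by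
      rw [← hgh']
      exact Finset.sum_congr rfl fun v hv => by rw [hp v hv, pow_one]
    obtain ⟨m, hm, hmdvd⟩ := exists_common_order (hg.zpow.mul hh.zpow : IsOfFinOrder α)
      (hg.zpow.mul hh.zpow : IsOfFinOrder β)
    have hNpos : 0 < N := hN.pos
    by_cases h4 : 4 ∣ m
    -- With m = 4q, take h = 2qN. Then ξ^h = 1, so the conjugation by 1 + h fixes the coefficients;
    -- the signs are nontrivial because m does not divide h, N being odd.
    · obtain ⟨q, rfl⟩ := h4
      have hpow := (hmdvd (2 * (2 * q * N))).2 ⟨N, by ring⟩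
      obtain ⟨ε, e1, e2, hsum⟩ := χ.exists_sign_sum_eq_zero (j := 1) (h := 2 * q * N)
        (by have : 0 < q := by omega
            positivity)
        (coprime_one_add_two_mul ((even_two_mul q).mul_right N))
        (by rw [show 2 * (2 * q * N) = N * (4 * q) by ring, pow_mul, hξ, one_pow])
        hpow.1 hpow.2 hrel
      have hε : ε ≠ 1 := by
        rintro rfl
        obtain ⟨t, ht⟩ := (hmdvd (2 * q * N)).1 ⟨by simpa using e1, by simpa using e2⟩
        have : N = 2 * t := by
          have hq : 0 < 2 * q := by omega
          apply Nat.eq_of_mul_eq_mul_left hq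
          rw [ht]; ring
        exact (Nat.not_even_iff_odd.2 hN) (this ▸ even_two_mul t)
      refine Finset.mem_union_left _ (Finset.mem_biUnion.2 ⟨ε, by simp [hε], ?_⟩)
      refine hT₁' ε hε _ h hgh ((χ.evalEval_sparse_eq_zero_iff g h 1 _).2 ?_)
      rw [← hsum]
      refine Finset.sum_congr rfl fun v hv => ?_
      rw [pow_add, show 2 * q * N = N * (2 * q) by ring, pow_mul, hξ, one_pow, mul_one, hp v hv]
      simp only [pow_one]
    -- Without the factor 4 the half-period h' can be taken odd, and the exponent 2 + h' sends ξ to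
    -- ξ² and the characters to their squares up to sign.
    · obtain ⟨h', hodd, hmh, hNh⟩ : ∃ h' : ℕ, Odd h' ∧ m ∣ 2 * h' ∧ N ∣ h' := by
        rcases Nat.even_or_odd' m with ⟨q, rfl | rfl⟩
        · have hq : Odd q := by
            rw [← Nat.not_even_iff_odd]
            rintro ⟨t, rfl⟩
            exact h4 ⟨t, by ring⟩
          exact ⟨q * N, hq.mul hN, ⟨N, by ring⟩, ⟨q, by ring⟩⟩
        · exact ⟨(2 * q + 1) * N, (odd_two_mul_add_one q).mul hN, ⟨2 * N, by ring⟩, ⟨2 * q + 1, by ring⟩⟩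
      have hpow := (hmdvd (2 * h')).2 hmh
      have hξ' : ξ ^ h' = 1 := by
        obtain ⟨t, rfl⟩ := hNh
        rw [pow_mul, hξ, one_pow]
      obtain ⟨ε, -, -, hsum⟩ := χ.exists_sign_sum_eq_zero (j := 2) (h := h') hodd.pos
        (coprime_two_add_two_mul hodd) (by rw [mul_comm, pow_mul, hξ', one_pow]) hpow.1 hpow.2 hrel
      refine Finset.mem_union_right _ (Finset.mem_biUnion.2 ⟨ε, Finset.mem_univ _, ?_⟩)
      refine hT₂' ε _ h hgh ((χ.evalEval_sparse_eq_zero_iff g h 2 _).2 ?_)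
      rw [← hsum]
      refine Finset.sum_congr rfl fun v _ => ?_
      rw [pow_add, hξ', mul_one]

/-- The values at `ξ ^ 2` of rational polynomials are the values at `ξ` which agree with the value
at `-ξ`. -/
theorem exists_aeval_sq {ξ : ℂ} {p : ℚ[X]} (h : aeval ξ p = aeval (-ξ) p) :
    ∃ q : ℚ[X], aeval ξ p = aeval (ξ ^ 2) q := by
  obtain ⟨q, r, rfl⟩ : ∃ q r : ℚ[X], p = q.comp (X ^ 2) + X * r.comp (X ^ 2) := by
    clear h
    induction p using Polynomial.induction_on' with
    | add p p' hp hp' =>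
      obtain ⟨q, r, rfl⟩ := hp
      obtain ⟨q', r', rfl⟩ := hp'
      exact ⟨q + q', r + r', by simp; ring⟩
    | monomial n a =>
      rcases Nat.even_or_odd' n with ⟨k, rfl | rfl⟩
      · exact ⟨C a * X ^ k, 0, by simp [← C_mul_X_pow_eq_monomial, pow_mul]⟩
      · exact ⟨0, C a * X ^ k, by simp [← C_mul_X_pow_eq_monomial]; ring⟩
  refine ⟨q, ?_⟩
  simp only [map_add, map_mul, aeval_X, aeval_comp, map_pow, neg_sq] at h ⊢
  have : ξ * aeval (ξ ^ 2) r = 0 := by linear_combination h / 2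
  rw [this, add_zero]

end LatticeChart

namespace LatticeChart
variable {s : Finset (ℕ × ℕ)} (χ : LatticeChart s)

/-- Exponents are reduced modulo N to stay in ℚ[X]; evenness of N lets the same reduction hold at
-ξ. -/
theorem exists_aeval_zpow {ξ : ℂˣ} {N : ℕ} (hN : Even N) (hN0 : 0 < N) (hξ : ξ ^ N = 1)
    (e : ℤˣ) (n : ℤ) : ∃ r : ℚ[X],
      aeval (ξ : ℂ) r = (((if e = 1 then 1 else ξ) ^ n : ℂˣ) : ℂ) ∧
      aeval (-ξ : ℂ) r = ((signUnit e ^ n * (if e = 1 then 1 else ξ) ^ n : ℂˣ) : ℂ) := by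
  have hmod : ∀ x : ℂˣ, x ^ N = 1 → x ^ n = x ^ (n % N).toNat := by
    intro x hx
    rw [← zpow_natCast, Int.toNat_of_nonneg (Int.emod_nonneg n (by omega))]
    conv_lhs => rw [← Int.emod_add_mul_ediv n N]
    rw [zpow_add, zpow_mul, zpow_natCast, hx, one_zpow, mul_one]
  rcases Int.units_eq_one_or e with rfl | rfl
  · exact ⟨1, by simp⟩
  · refine ⟨X ^ (n % N).toNat, ?_, ?_⟩
    · rw [if_neg (by decide), hmod ξ hξ]
      simp
    · have h1 : signUnit (-1) ^ n * ξ ^ n = (-ξ) ^ n := by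
        rw [← mul_zpow]
        congr 1
        exact Units.ext (by simp [signUnit])
      rw [if_neg (by decide), h1, hmod (-ξ) (by rw [hN.neg_pow, hξ])]
      simp

/-- Torsion points on a plane curve with coefficients in a cyclotomic field. -/
theorem exists_torsion_finset_of_cyclotomic (hs : 0 < s.sup Prod.snd) (N : ℕ) :
    ∀ (ξ : ℂ) (c : ℕ × ℕ → ℂ), 0 < N → orderOf ξ = N → (∀ v ∈ s, c v ≠ 0) → c χ.base = 1 →
      Irreducible (sparse 1 s c) → (∀ v ∈ s, ∃ p : ℚ[X], c v = aeval ξ p) →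
      ∃ T : Finset ℂ, T.card ≤ 22 * (s.sup Prod.fst * s.sup Prod.snd) ∧
        ∀ g h : ℂˣ, IsOfFinOrder g → IsOfFinOrder h → (sparse 1 s c).evalEval (g : ℂ) (h : ℂ) = 0 →
          (g : ℂ) ∈ T := by
  classical
  induction N using Nat.strong_induction_on with
  | _ N ih =>
  intro ξ c hN0 hord hc h0 hP hcyc
  have hξN : ξ ^ N = 1 := hord ▸ pow_orderOf_eq_one ξ
  have hξ0 : ξ ≠ 0 := by
    rintro rfl
    rw [zero_pow hN0.ne'] at hξN
    exact zero_ne_one hξN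
  -- Choosing the polynomial 1 at the base keeps every conjugate normalized there.
  obtain ⟨p, hp, hp0⟩ : ∃ p : ℕ × ℕ → ℚ[X], (∀ v ∈ s, c v = aeval ξ (p v)) ∧ p χ.base = 1 := by
    choose! p hp using hcyc
    refine ⟨Function.update p χ.base 1, fun v hv => ?_, by simp⟩
    by_cases h : v = χ.base
    · subst h; simp [h0]
    · rw [Function.update_of_ne h]; exact hp v hv
  rcases Nat.even_or_odd' N with ⟨q, hq | hq⟩
  swap
  · exact χ.exists_torsion_finset_of_odd hs hc h0 hP (hq ▸ odd_two_mul_add_one q) hξN p hp hp0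
  rcases Nat.even_or_odd q with hqe | hqo
  swap
  -- For N = 2q with q odd, -ξ satisfies (-ξ)^q = 1, which returns to odd conductor.
  · have h1 : ξ ^ q = -1 := by
      have h2 : ξ ^ q * ξ ^ q = 1 := by rw [← pow_add, ← two_mul, ← hq, hξN]
      refine (mul_self_eq_one_iff.1 h2).resolve_left fun h => ?_
      have := Nat.le_of_dvd (by omega) (orderOf_dvd_of_pow_eq_one h)
      omega
    refine χ.exists_torsion_finset_of_odd hs hc h0 hP hqo (ξ := -ξ) ?_ (fun v => (p v).comp (-X))
      (fun v hv => ?_) (by simp [hp0])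
    · rw [hqo.neg_pow, h1, neg_neg]
    · rw [aeval_comp, hp v hv]; simp
  -- Now 4 divides N. Either the conjugate under ξ ↦ -ξ is a sign twist of P and the conductor can
  -- be halved, or every nontrivial combination of conjugation and signs gives a new polynomial.
  by_cases H : ∃ ε : ℤˣ × ℤˣ, ∀ v ∈ s, aeval (-ξ) (p v) * (χ.sign ε v : ℂ) = aeval ξ (p v)
  · obtain ⟨ε, hε⟩ := H
    set ξu : ℂˣ := Units.mk0 ξ hξ0
    have hξu : ξu ^ N = 1 := Units.ext hξN
    -- Replacing ξ by -ξ changes the character with values ω by exactly the sign ε, so the twisted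
    -- coefficients are invariant and lie in ℚ(ξ²).
    set ω : ℤˣ → ℂˣ := fun e => if e = 1 then 1 else ξu
    have hω : ∀ e, IsOfFinOrder (ω e) := by
      intro e
      refine isOfFinOrder_iff_pow_eq_one.2 ⟨N, hN0, ?_⟩
      simp only [ω]
      split_ifs
      · exact one_pow _
      · exact hξu
    obtain ⟨g₀, h₀, hg₀, hh₀, hfin⟩ := exists_scaled_roots χ.det_ne (ω ε.1) (ω ε.2)
    obtain ⟨hg₀f, hh₀f⟩ := hfin (hω _) (hω _)
    have hord2 : orderOf (ξ ^ 2) = q := by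
      rw [orderOf_pow' ξ two_ne_zero, hord, hq, Nat.gcd_eq_right (dvd_mul_right 2 q)]
      simp
    obtain ⟨T, hT, hT'⟩ := ih q (by omega) (ξ ^ 2) (fun v => c v * (χ.char (ω ε.1) (ω ε.2) v : ℂ))
      (by omega) hord2 (fun v hv => mul_ne_zero (hc v hv) (Units.ne_zero _)) (by simp [h0])
      (χ.irreducible_twist hP _ _) (fun v hv => by
        obtain ⟨r₁, h1, h1'⟩ := exists_aeval_zpow ⟨q, by omega⟩ hN0 hξu ε.1 (χ.n₁ v)
        obtain ⟨r₂, h2, h2'⟩ := exists_aeval_zpow ⟨q, by omega⟩ hN0 hξu ε.2 (χ.n₂ v)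
        have e1 : aeval ξ (p v * r₁ * r₂) = c v * (χ.char (ω ε.1) (ω ε.2) v : ℂ) := by
          change aeval ξ r₁ = _ at h1
          change aeval ξ r₂ = _ at h2
          rw [map_mul, map_mul, h1, h2, hp v hv, char, Units.val_mul, mul_assoc]
        have e2 : aeval (-ξ) (p v * r₁ * r₂) = c v * (χ.char (ω ε.1) (ω ε.2) v : ℂ) := by
          change aeval (-ξ) r₁ = _ at h1'
          change aeval (-ξ) r₂ = _ at h2'
          rw [map_mul, map_mul, h1', h2', hp v hv, ← hε v hv, char, sign, char]
          simp only [Units.val_mul, ω]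
          ring
        rw [← e1]
        exact exists_aeval_sq (e1.trans e2.symm))
    -- The twist is translation by the torsion point (g₀, h₀), so torsion zeros go to torsion zeros.
    refine ⟨T.image (· * (g₀ : ℂ)), Finset.card_image_le.trans hT, fun g h hg hh hgh => ?_⟩
    rw [Finset.mem_image]
    refine ⟨((g * g₀⁻¹ : ℂˣ) : ℂ), hT' _ (h * h₀⁻¹) (hg.mul hg₀f.inv) (hh.mul hh₀f.inv) ?_, ?_⟩
    · rw [χ.evalEval_sparse_eq_zero_iff] at hgh ⊢
      rw [← hgh]
      refine Finset.sum_congr rfl fun v _ => ?_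
      have e1 : (g * g₀⁻¹) ^ χ.u.1 * (h * h₀⁻¹) ^ χ.u.2 = g ^ χ.u.1 * h ^ χ.u.2 * (ω ε.1)⁻¹ := by
        rw [← hg₀, mul_zpow, mul_zpow, mul_inv, inv_zpow, inv_zpow, mul_mul_mul_comm]
      have e2 : (g * g₀⁻¹) ^ χ.w.1 * (h * h₀⁻¹) ^ χ.w.2 = g ^ χ.w.1 * h ^ χ.w.2 * (ω ε.2)⁻¹ := by
        rw [← hh₀, mul_zpow, mul_zpow, mul_inv, inv_zpow, inv_zpow, mul_mul_mul_comm]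
      rw [e1, e2, pow_one, pow_one, mul_assoc, ← Units.val_mul, ← char_mul]
      simp
    · simp
  · push Not at H
    set AB := s.sup Prod.fst * s.sup Prod.snd
    let c' : ℤˣ × (ℤˣ × ℤˣ) → ℕ × ℕ → ℂ := fun κ v =>
      aeval ((signUnit κ.1 : ℂ) * ξ) (p v) * (χ.sign κ.2 v : ℂ)
    have h1 : ∀ κ, ∃ T : Finset ℂ, T.card ≤ 2 * 1 * AB ∧ (κ ≠ 1 →
        ∀ y z, (sparse 1 s c).evalEval y z = 0 → (sparse 1 s (c' κ)).evalEval y z = 0 → y ∈ T) := by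
      rintro ⟨δ, ε⟩
      by_cases hκ : (δ, ε) = 1
      · exact ⟨∅, by simp, fun h => absurd hκ h⟩
      · have hnd : ¬ sparse 1 s c ∣ sparse 1 s (c' (δ, ε)) := by
          intro hd
          have heq := eq_of_sparse_dvd_sparse hc χ.base_mem h0 (by simp [c', hp0]) hd
          rcases Int.units_eq_one_or δ with rfl | rfl
          · refine hκ (Prod.ext rfl (χ.sign_eq_imp fun v hv => Units.ext
              (mul_left_cancel₀ (hc v hv) ?_)))
            have := heq v hv
            simp only [c', map_one, Units.val_one, one_mul, ← hp v hv] at this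
            rw [← this]
            simp [sign, char]
          · obtain ⟨v, hv, hne⟩ := H ε
            apply hne
            rw [← hp v hv, heq v hv]
            simp [c', signUnit]
        obtain ⟨T, hT, hT'⟩ := exists_finset_fst_of_sparse_not_dvd hc hP hs hnd
        exact ⟨T, hT, fun _ => hT'⟩
    choose T hT hT' using h1
    -- Seven nontrivial combinations at 2AB each give 14AB.
    refine ⟨(Finset.univ.erase 1).biUnion T, ?_, fun g h hg hh hgh => ?_⟩
    · have e1 := Finset.card_biUnion_le_card_mul (Finset.univ.erase (1 : ℤˣ × (ℤˣ × ℤˣ))) T _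
        fun κ _ => hT κ
      have h8 : (Finset.univ : Finset (ℤˣ × (ℤˣ × ℤˣ))).card = 8 := rfl
      rw [Finset.card_erase_of_mem (Finset.mem_univ _), h8] at e1
      omega
    · have hgh' := (χ.evalEval_sparse_eq_zero_iff g h 1 c).1 hgh
      obtain ⟨α, hα⟩ : ∃ α, α = g ^ χ.u.1 * h ^ χ.u.2 := ⟨_, rfl⟩
      obtain ⟨β, hβ⟩ : ∃ β, β = g ^ χ.w.1 * h ^ χ.w.2 := ⟨_, rfl⟩
      rw [← hα, ← hβ] at hgh'
      have hrel : ∑ v ∈ s, aeval ξ (p v) * (χ.char α β v : ℂ) = 0 := by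
        rw [← hgh']
        exact Finset.sum_congr rfl fun v hv => by rw [hp v hv, pow_one]
      obtain ⟨m, hm, hmdvd⟩ := exists_common_order (hα ▸ hg.zpow.mul hh.zpow : IsOfFinOrder α)
        (hβ ▸ hg.zpow.mul hh.zpow : IsOfFinOrder β)
      -- Conjugation by 1 + 2h', with 4h' = lcm(N, m), multiplies ξ, α, β by signs; were all
      -- trivial, the lcm would divide its own half.
      obtain ⟨h', hh'⟩ : 4 ∣ Nat.lcm N m := by
        obtain ⟨t, rfl⟩ := hqe
        exact dvd_trans ⟨t, by omega⟩ (Nat.dvd_lcm_left N m)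
      have hlpos := Nat.lcm_pos hN0 hm
      have hh'' : Nat.lcm N m = 2 * (2 * h') := by omega
      have hpow := (hmdvd (2 * (2 * h'))).2 (hh'' ▸ Nat.dvd_lcm_right N m)
      have hξpow : ξ ^ (2 * (2 * h')) = 1 := by
        rw [← orderOf_dvd_iff_pow_eq_one, hord, ← hh'']
        exact Nat.dvd_lcm_left N m
      obtain ⟨ε, e1, e2, hsum⟩ := χ.exists_sign_sum_eq_zero (j := 1) (h := 2 * h') (by omega)
        (coprime_one_add_two_mul (even_two_mul h')) hξpow hpow.1 hpow.2 hrel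
      have hξu2 : (Units.mk0 ξ hξ0 ^ (2 * h')) ^ 2 = 1 := by
        rw [← pow_mul, mul_comm]; exact Units.ext hξpow
      obtain ⟨δ, hδ⟩ := exists_signUnit_of_sq_eq_one hξu2
      have hδ' : ξ ^ (2 * h') = (signUnit δ : ℂ) := by rw [← hδ]; rfl
      have hκ : (δ, ε) ≠ 1 := by
        rintro h
        obtain ⟨rfl, rfl⟩ := Prod.mk.inj h
        have d1 : N ∣ 2 * h' := by
          rw [← hord, orderOf_dvd_iff_pow_eq_one, hδ']; simp
        have d2 : m ∣ 2 * h' := (hmdvd _).1 ⟨by simpa using e1, by simpa using e2⟩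
        have := Nat.le_of_dvd (by omega) (Nat.lcm_dvd d1 d2)
        omega
      refine Finset.mem_biUnion.2 ⟨(δ, ε), by simp [hκ], ?_⟩
      refine hT' _ hκ _ h hgh ((χ.evalEval_sparse_eq_zero_iff g h 1 _).2 ?_)
      rw [← hα, ← hβ, ← hsum]
      refine Finset.sum_congr rfl fun v hv => ?_
      rw [pow_add, hδ', pow_one ξ, mul_comm ξ]

end LatticeChart

/-! ### Construction of lattice charts. -/

/-- The differences span a free group of rank at most 2, and rank 0 or 1 would put the exponents on
a line. Primitivity holds because a character trivial on generators is trivial on a basis. -/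
theorem exists_latticeChart {s : Finset (ℕ × ℕ)} {v₀ : ℕ × ℕ} (hv₀ : v₀ ∈ s)
    (h : ∀ u : ℤ × ℤ, ¬ ∀ v ∈ s, ∃ k : ℤ, (v.1 : ℤ) = v₀.1 + k * u.1 ∧ (v.2 : ℤ) = v₀.2 + k * u.2) :
    ∃ χ : LatticeChart s, χ.base = v₀ := by
  classical
  let d : ℕ × ℕ → ℤ × ℤ := fun v => ((v.1 : ℤ) - v₀.1, (v.2 : ℤ) - v₀.2)
  let L := Submodule.span ℤ (d '' s)
  have hd : ∀ v ∈ s, d v ∈ L := fun v hv => Submodule.subset_span ⟨v, hv, rfl⟩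
  have hrank : Module.finrank ℤ L ≤ 2 := (Submodule.finrank_le L).trans (by simp)
  obtain ⟨k, hk⟩ : ∃ k, k = Module.finrank ℤ L := ⟨_, rfl⟩
  rw [← hk] at hrank
  let b : Module.Basis (Fin k) ℤ L := Module.finBasisOfFinrankEq ℤ L hk.symm
  interval_cases k
  · exfalso
    refine h 0 fun v hv => ⟨0, ?_⟩
    have h1 := b.sum_repr ⟨d v, hd v hv⟩
    rw [Finset.univ_eq_empty, Finset.sum_empty] at h1
    have h2 : (0 : ℤ × ℤ) = d v := congrArg Subtype.val h1
    have h3 := congrArg Prod.fst h2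
    have h4 := congrArg Prod.snd h2
    simp only [d, Prod.fst_zero, Prod.snd_zero] at h3 h4
    constructor <;> simp <;> omega
  · exfalso
    refine h (b 0 : ℤ × ℤ) fun v hv => ⟨b.repr ⟨d v, hd v hv⟩ 0, ?_⟩
    have h1 := b.sum_repr ⟨d v, hd v hv⟩
    rw [Fin.sum_univ_one] at h1
    have h2 : b.repr ⟨d v, hd v hv⟩ 0 • (b 0 : ℤ × ℤ) = d v := congrArg Subtype.val h1
    have h3 := congrArg Prod.fst h2
    have h4 := congrArg Prod.snd h2
    simp only [d, Prod.smul_fst, Prod.smul_snd, smul_eq_mul] at h3 h4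
    constructor <;> linarith
  · have hlin : ∀ x y : ℤ, x • (b 0 : ℤ × ℤ) + y • (b 1 : ℤ × ℤ) = 0 → x = 0 ∧ y = 0 := by
      intro x y hxy
      have := Fintype.linearIndependent_iff.1 b.linearIndependent ![x, y] (by
        rw [Fin.sum_univ_two]
        exact Subtype.ext hxy)
      exact ⟨this 0, this 1⟩
    let n : Fin 2 → ℕ × ℕ → ℤ := fun i v => if hv : v ∈ s then b.repr ⟨d v, hd v hv⟩ i else 0
    have hn : ∀ v ∈ s, n 0 v • (b 0 : ℤ × ℤ) + n 1 v • (b 1 : ℤ × ℤ) = d v := by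
      intro v hv
      have h1 := b.sum_repr ⟨d v, hd v hv⟩
      rw [Fin.sum_univ_two] at h1
      simp only [n, dif_pos hv]
      exact congrArg Subtype.val h1
    refine ⟨⟨v₀, hv₀, b 0, b 1, ?_, n 0, n 1, ?_, ?_, ?_⟩, rfl⟩
    · intro hdet
      have e1 := hlin (b 1 : ℤ × ℤ).2 (-(b 0 : ℤ × ℤ).2) (Prod.ext
        (by simp; linarith) (by simp; ring))
      have e2 := hlin (b 1 : ℤ × ℤ).1 (-(b 0 : ℤ × ℤ).1) (Prod.ext
        (by simp; ring) (by simp; linarith))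
      have : b 0 = 0 := Subtype.ext (Prod.ext (neg_eq_zero.1 e2.2) (neg_eq_zero.1 e1.2))
      exact b.ne_zero 0 this
    · intro v hv
      have := congrArg Prod.fst (hn v hv)
      simp only [d, Prod.fst_add, Prod.smul_fst, smul_eq_mul] at this
      linarith
    · intro v hv
      have := congrArg Prod.snd (hn v hv)
      simp only [d, Prod.snd_add, Prod.smul_snd, smul_eq_mul] at this
      linarith
    · intro ε hε
      have key : ∀ x : ℤ × ℤ, ∀ hx : x ∈ L, ε.1 ^ b.repr ⟨x, hx⟩ 0 * ε.2 ^ b.repr ⟨x, hx⟩ 1 = 1 := by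
        intro x hx
        induction hx using Submodule.span_induction with
        | mem x hx =>
          obtain ⟨v, hv, rfl⟩ := hx
          have := hε v hv
          simpa only [n, dif_pos (Finset.mem_coe.1 hv)] using this
        | zero =>
          have : (⟨0, L.zero_mem⟩ : L) = 0 := rfl
          simp [this]
        | add x y hx hy ihx ihy =>
          have : (⟨x + y, L.add_mem hx hy⟩ : L) = ⟨x, hx⟩ + ⟨y, hy⟩ := rfl
          rw [this, map_add, Finsupp.add_apply, Finsupp.add_apply, zpow_add, zpow_add,
            mul_mul_mul_comm]
          erw [ihx, ihy]
          rfl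
        | smul a x hx ihx =>
          have : (⟨a • x, L.smul_mem a hx⟩ : L) = a • ⟨x, hx⟩ := rfl
          rw [this, map_smul, Finsupp.smul_apply, Finsupp.smul_apply, smul_eq_mul, smul_eq_mul,
            mul_comm a, mul_comm a, zpow_mul, zpow_mul, ← mul_zpow]
          erw [ihx]
          exact one_zpow a
      refine Prod.ext ?_ ?_
      · simpa using key (b 0) (b 0).2
      · simpa using key (b 1) (b 1).2

/-! ### From cyclotomic to arbitrary coefficients. -/

/-- The field generated by all roots of unity. -/
def cyclotomicClosure : IntermediateField ℚ ℂ := IntermediateField.adjoin ℚ {x | IsOfFinOrder x}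

theorem exists_aeval_of_dvd {ξ ξ' : ℂ} {t : ℕ} (h : ξ' ^ t = ξ) {x : ℂ}
    (hx : ∃ p : ℚ[X], x = aeval ξ p) : ∃ p : ℚ[X], x = aeval ξ' p := by
  obtain ⟨p, rfl⟩ := hx
  exact ⟨p.comp (X ^ t), by simp [aeval_comp, h]⟩

theorem exp_two_pi_I_div_pow {n t : ℕ} (ht : 0 < t) :
    Complex.exp (2 * Real.pi * Complex.I / (n * t : ℕ)) ^ t =
      Complex.exp (2 * Real.pi * Complex.I / n) := by
  rw [← Complex.exp_nat_mul]
  congr 1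
  have : (t : ℂ) ≠ 0 := by exact_mod_cast ht.ne'
  rcases eq_or_ne (n : ℂ) 0 with h | h
  · simp [h]
  · push_cast
    field_simp

theorem exists_aeval_exp_of_mem_cyclotomicClosure {x : ℂ} (hx : x ∈ cyclotomicClosure) :
    ∃ n : ℕ, 0 < n ∧ ∃ p : ℚ[X], x = aeval (Complex.exp (2 * Real.pi * Complex.I / n)) p := by
  have halg : ∀ x ∈ {x : ℂ | IsOfFinOrder x}, IsAlgebraic ℚ x := by
    intro x hx
    obtain ⟨n, hn, hxn⟩ := isOfFinOrder_iff_pow_eq_one.1 hx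
    exact ⟨X ^ n - 1, (monic_X_pow_sub_C 1 hn.ne').ne_zero, by simp [hxn]⟩
  have hmem : x ∈ Algebra.adjoin ℚ {x : ℂ | IsOfFinOrder x} := by
    rw [← IntermediateField.adjoin_toSubalgebra_of_isAlgebraic halg]
    exact hx
  have hcommon : ∀ x y : ℂ,
      (∃ n : ℕ, 0 < n ∧ ∃ p : ℚ[X], x = aeval (Complex.exp (2 * Real.pi * Complex.I / n)) p) →
      (∃ n : ℕ, 0 < n ∧ ∃ p : ℚ[X], y = aeval (Complex.exp (2 * Real.pi * Complex.I / n)) p) →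
      ∃ n : ℕ, 0 < n ∧ ∃ p q : ℚ[X], x = aeval (Complex.exp (2 * Real.pi * Complex.I / n)) p ∧
        y = aeval (Complex.exp (2 * Real.pi * Complex.I / n)) q := by
    rintro x y ⟨n, hn, hx⟩ ⟨n', hn', hy⟩
    obtain ⟨p, hp⟩ := exists_aeval_of_dvd (exp_two_pi_I_div_pow hn') hx
    obtain ⟨q, hq⟩ := exists_aeval_of_dvd (exp_two_pi_I_div_pow hn) hy
    rw [mul_comm n'] at hq
    exact ⟨n * n', Nat.mul_pos hn hn', p, q, hp, hq⟩
  clear hx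
  induction hmem using Algebra.adjoin_induction with
  | mem x hx =>
    obtain ⟨n, hn, hxn⟩ := isOfFinOrder_iff_pow_eq_one.1 hx
    have : NeZero n := ⟨hn.ne'⟩
    obtain ⟨i, -, rfl⟩ := (Complex.isPrimitiveRoot_exp n hn.ne').eq_pow_of_pow_eq_one hxn
    exact ⟨n, hn, X ^ i, by simp⟩
  | algebraMap r => exact ⟨1, one_pos, C r, by simp⟩
  | add x y _ _ ihx ihy =>
    obtain ⟨n, hn, p, q, rfl, rfl⟩ := hcommon x y ihx ihy
    exact ⟨n, hn, p + q, by simp⟩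
  | mul x y _ _ ihx ihy =>
    obtain ⟨n, hn, p, q, rfl, rfl⟩ := hcommon x y ihx ihy
    exact ⟨n, hn, p * q, by simp⟩

theorem exists_common_cyclotomic (s : Finset (ℕ × ℕ)) (c : ℕ × ℕ → ℂ)
    (hc : ∀ v ∈ s, c v ∈ cyclotomicClosure) :
    ∃ n : ℕ, 0 < n ∧ ∀ v ∈ s, ∃ p : ℚ[X],
      c v = aeval (Complex.exp (2 * Real.pi * Complex.I / n)) p := by
  classical
  choose! n hn p hp using fun v hv => exists_aeval_exp_of_mem_cyclotomicClosure (hc v hv)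
  refine ⟨∏ v ∈ s, n v, Finset.prod_pos hn, fun v hv => ?_⟩
  have h1 : 0 < ∏ w ∈ s.erase v, n w :=
    Finset.prod_pos fun w hw => hn w (Finset.mem_of_mem_erase hw)
  rw [← Finset.mul_prod_erase s n hv]
  exact exists_aeval_of_dvd (exp_two_pi_I_div_pow h1) ⟨p v, hp v hv⟩

namespace LatticeChart
variable {s : Finset (ℕ × ℕ)} (χ : LatticeChart s)

/-- Torsion points on a plane curve with arbitrary complex coefficients. -/
theorem exists_torsion_finset (hs : 0 < s.sup Prod.snd) {c : ℕ × ℕ → ℂ} (hc : ∀ v ∈ s, c v ≠ 0)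
    (h0 : c χ.base = 1) (hP : Irreducible (sparse 1 s c)) :
    ∃ T : Finset ℂ, T.card ≤ 22 * (s.sup Prod.fst * s.sup Prod.snd) ∧
      ∀ g h : ℂˣ, IsOfFinOrder g → IsOfFinOrder h → (sparse 1 s c).evalEval (g : ℂ) (h : ℂ) = 0 →
        (g : ℂ) ∈ T := by
  by_cases hcyc : ∀ v ∈ s, c v ∈ cyclotomicClosure
  · obtain ⟨n, hn, hp⟩ := exists_common_cyclotomic s c hcyc
    exact χ.exists_torsion_finset_of_cyclotomic hs n _ c hn
      (Complex.isPrimitiveRoot_exp n hn.ne').eq_orderOf.symm hc h0 hP hp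
  -- A linear retraction l of ℂ onto the cyclotomic closure preserves the relation, since its
  -- monomials lie in that field. Divisibility by P would force all c v to equal l (c v).
  · obtain ⟨l, hl⟩ := LinearMap.exists_leftInverse_of_injective
      (Algebra.linearMap cyclotomicClosure ℂ)
      (LinearMap.ker_eq_bot.2 (algebraMap cyclotomicClosure ℂ).injective)
    have hl1 : ∀ x : cyclotomicClosure, l x = x := fun x => LinearMap.congr_fun hl x
    have hnd : ¬ sparse 1 s c ∣ sparse 1 s fun v => (l (c v) : ℂ) := by
      intro hd
      refine hcyc fun v hv => ?_
      have h1 : ((l (c χ.base) : cyclotomicClosure) : ℂ) = 1 := by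
        rw [h0]
        exact congrArg Subtype.val (hl1 1)
      rw [eq_of_sparse_dvd_sparse hc χ.base_mem h0 h1 hd v hv]
      exact (l (c v)).2
    obtain ⟨T, hT, hT'⟩ := exists_finset_fst_of_sparse_not_dvd hc hP hs hnd
    refine ⟨T, by omega, fun g h hg hh hgh => hT' g h hgh ?_⟩
    have hmem : ∀ v : ℕ × ℕ, ((g : ℂ) ^ v.1 * (h : ℂ) ^ v.2) ∈ cyclotomicClosure := by
      have h1 : ∀ x : ℂˣ, IsOfFinOrder x → (x : ℂ) ∈ cyclotomicClosure := fun x hx =>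
        IntermediateField.subset_adjoin _ _ (Units.isOfFinOrder_val.2 hx)
      exact fun v => mul_mem (pow_mem (h1 g hg) _) (pow_mem (h1 h hh) _)
    rw [evalEval_sparse] at hgh ⊢
    have h2 := congrArg (fun x => ((l x : cyclotomicClosure) : ℂ)) hgh
    simp only [pow_one, map_zero, ZeroMemClass.coe_zero] at h2 ⊢
    rw [← h2, map_sum, AddSubmonoidClass.coe_finsetSum]
    refine Finset.sum_congr rfl fun v _ => ?_
    have h3 : c v * ((g : ℂ) ^ v.1 * (h : ℂ) ^ v.2) =
        (⟨_, hmem v⟩ : cyclotomicClosure) • c v := mul_comm _ _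
    rw [h3, map_smul, mul_comm]
    rfl

end LatticeChart

/-! ### Coding lists of Jordan blocks by words. -/

section BlockCodes
variable {α : Type*}

/-- The block `(a, e)` coded by `e` letters, of which the last one is marked. -/
def blockCode (b : α × ℕ) : List (α × Bool) := List.replicate (b.2 - 1) (b.1, false) ++ [(b.1, true)]

/-- Left inverse of the coding of a list of blocks by `blockCode`. -/
def blockDecode : List (α × Bool) → List (α × ℕ)
  | [] => []
  | (a, true) :: t => (a, 1) :: blockDecode t
  | (_, false) :: t => match blockDecode t with
    | [] => []
    | (b, e) :: u => (b, e + 1) :: u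

theorem blockDecode_flatMap (l : List (α × ℕ)) (hl : ∀ b ∈ l, 1 ≤ b.2) :
    blockDecode (l.flatMap blockCode) = l := by
  induction l with
  | nil => rfl
  | cons b l ih =>
    obtain ⟨a, e⟩ := b
    have ih' := ih fun b hb => hl b (List.mem_cons_of_mem _ hb)
    have key : ∀ n, blockDecode (List.replicate n (a, false) ++ (a, true) :: l.flatMap blockCode)
        = (a, n + 1) :: l := by
      intro n
      induction n with
      | zero => simp [blockDecode, ih']
      | succ n hn => simp [List.replicate_succ, blockDecode, hn]
    have he : 1 ≤ e := hl (a, e) List.mem_cons_self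
    have := key (e - 1)
    rw [Nat.sub_add_cancel he] at this
    simpa [blockCode] using this

theorem length_flatMap_blockCode (l : List (α × ℕ)) (hl : ∀ b ∈ l, 1 ≤ b.2) :
    (l.flatMap blockCode).length = (l.map Prod.snd).sum := by
  induction l with
  | nil => rfl
  | cons b l ih =>
    have := hl b List.mem_cons_self
    simp [ih fun b hb => hl b (List.mem_cons_of_mem _ hb), blockCode]
    omega

theorem fst_mem_of_mem_flatMap_blockCode (l : List (α × ℕ)) {x : α × Bool}
    (hx : x ∈ l.flatMap blockCode) : ∃ b ∈ l, b.1 = x.1 := by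
  obtain ⟨b, hb, hx⟩ := List.mem_flatMap.1 hx
  refine ⟨b, hb, ?_⟩
  rcases List.mem_append.1 hx with h | h
  · rw [List.eq_of_mem_replicate h]
  · rw [List.mem_singleton.1 h]

theorem encard_lists_le (S : Finset α) (r : ℕ) :
    {L : List (α × Bool) | L.length = r ∧ ∀ x ∈ L, x.1 ∈ S}.encard ≤ ((2 * S.card) ^ r : ℕ) := by
  classical
  have : {L : List (α × Bool) | L.length = r ∧ ∀ x ∈ L, x.1 ∈ S} ⊆
      (fun v : Fin r → α × Bool => List.ofFn v) ''
        (Fintype.piFinset fun _ : Fin r => S ×ˢ (Finset.univ : Finset Bool) : Set _) := by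
    rintro L ⟨rfl, hL⟩
    refine ⟨L.get, ?_, List.ofFn_get L⟩
    simp only [Finset.mem_coe, Fintype.mem_piFinset, Finset.mem_product, Finset.mem_univ, and_true]
    exact fun i => hL _ (List.get_mem _ _)
  refine (Set.encard_le_encard this).trans ((Set.encard_image_le _ _).trans ?_)
  rw [Set.encard_coe_eq_coe_finsetCard, Fintype.card_piFinset]
  simp [mul_comm]

end BlockCodes

/-! ### Conjugacy classes with prescribed spectrum. -/

section ConjugacyClasses
variable {r : ℕ}

/-- An isomorphism of ℂ[X]-modules is an invertible matrix intertwining A and B. -/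
theorem isConj_of_linearEquiv_aeval {A B : CMat r}
    (φ : Module.AEval' (Matrix.toLin' A) ≃ₗ[ℂ[X]] Module.AEval' (Matrix.toLin' B)) :
    IsConj A B := by
  let ψ : (Fin r → ℂ) ≃ₗ[ℂ] (Fin r → ℂ) :=
    (Module.AEval'.of (Matrix.toLin' A)).trans
      ((φ.restrictScalars ℂ).trans (Module.AEval'.of (Matrix.toLin' B)).symm)
  have hψ : ∀ v, ψ (A.mulVec v) = B.mulVec (ψ v) := by
    intro v
    have h1 := Module.AEval'.X_smul_of (Matrix.toLin' A) v
    have h2 := Module.AEval'.X_smul_of (Matrix.toLin' B) (ψ v)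
    rw [← Matrix.toLin'_apply, ← Matrix.toLin'_apply]
    apply (Module.AEval'.of (Matrix.toLin' B)).injective
    rw [← h2]
    simp only [ψ, LinearEquiv.trans_apply, LinearEquiv.apply_symm_apply, ← h1]
    simp
  have hu : LinearMap.toMatrix' (ψ : (Fin r → ℂ) →ₗ[ℂ] (Fin r → ℂ)) *
      LinearMap.toMatrix' (ψ.symm : (Fin r → ℂ) →ₗ[ℂ] (Fin r → ℂ)) = 1 := by
    rw [← LinearMap.toMatrix'_comp]; simp
  refine ⟨⟨_, _, hu, mul_eq_one_comm.1 hu⟩, ?_⟩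
  rw [SemiconjBy]
  apply Matrix.toLin'.injective
  refine LinearMap.ext fun v => ?_
  simp [Matrix.toLin'_mul, hψ]


/-- The elementary divisors of a complex matrix. -/
theorem exists_linearEquiv_aeval_pi (A : CMat r) :
    ∃ (n : ℕ) (b : Fin n → ℂ × ℕ), (∀ i, 1 ≤ (b i).2 ∧ A.charpoly.IsRoot (b i).1) ∧
      ∑ i, (b i).2 = r ∧ Nonempty (Module.AEval' (Matrix.toLin' A) ≃ₗ[ℂ[X]]
        ((i : Fin n) → ℂ[X] ⧸ Ideal.span {(X - C (b i).1) ^ (b i).2})) := by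
  classical
  set M := Module.AEval' (Matrix.toLin' A)
  have hann : ∀ m : M, A.charpoly • m = 0 := by
    intro m
    apply (Module.AEval'.of (Matrix.toLin' A)).symm.injective
    have : aeval (Matrix.toLin' A) A.charpoly = 0 := by
      rw [← Matrix.charpoly_toLin']
      exact LinearMap.aeval_self_charpoly _
    rw [Module.AEval.of_symm_smul, this, zero_smul, map_zero]
  have htors : Module.IsTorsion ℂ[X] M := fun {m} =>
    ⟨⟨A.charpoly, mem_nonZeroDivisors_of_ne_zero (Matrix.charpoly_monic A).ne_zero⟩, hann m⟩
  obtain ⟨ι, _, p, hp, e, ⟨φ⟩⟩ := Module.equiv_directSum_of_isTorsion htors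
  have hroot : ∀ i, ∃ l, Associated (p i) (X - C l) := by
    intro i
    obtain ⟨l, hl⟩ := IsAlgClosed.exists_root (p i) (degree_pos_of_irreducible (hp i)).ne'
    exact ⟨l, ((irreducible_X_sub_C l).associated_of_dvd (hp i) (dvd_iff_isRoot.2 hl)).symm⟩
  choose l hl using hroot
  have hspan : ∀ i, Ideal.span {p i ^ e i} = Ideal.span {(X - C (l i)) ^ e i} := fun i =>
    Ideal.span_singleton_eq_span_singleton.2 ((hl i).pow_pow)
  -- The structure theorem may return zero exponents; these trivial summands must go, since a block
  -- needs at least one letter.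
  let J := {i // e i ≠ 0}
  let σ : J ≃ Fin (Fintype.card J) := Fintype.equivFin J
  let φ' : M ≃ₗ[ℂ[X]] ((i : ι) → ℂ[X] ⧸ Ideal.span {p i ^ e i}) :=
    φ.trans (DirectSum.linearEquivFunOnFintype ℂ[X] ι _)
  let b : Fin (Fintype.card J) → ℂ × ℕ := fun k => (l (σ.symm k).1, e (σ.symm k).1)
  let Φ : ((i : ι) → ℂ[X] ⧸ Ideal.span {p i ^ e i}) →ₗ[ℂ[X]]
      ((k : Fin (Fintype.card J)) → ℂ[X] ⧸ Ideal.span {(X - C (b k).1) ^ (b k).2}) :=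
    LinearMap.pi fun k =>
      (Submodule.quotEquivOfEq _ _ (hspan (σ.symm k).1)).toLinearMap ∘ₗ LinearMap.proj (σ.symm k).1
  have hΦinj : Function.Injective Φ := by
    rw [injective_iff_map_eq_zero]
    intro f hf
    funext i
    by_cases hi : e i = 0
    · have : Subsingleton (ℂ[X] ⧸ Ideal.span {p i ^ e i}) := by
        rw [Ideal.Quotient.subsingleton_iff, hi, pow_zero, Ideal.span_singleton_one]
      exact Subsingleton.elim _ _
    · obtain ⟨k, hk⟩ : ∃ k, (σ.symm k).1 = i := ⟨σ ⟨i, hi⟩, by simp⟩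
      subst hk
      exact (Submodule.quotEquivOfEq _ _ (hspan (σ.symm k).1)).map_eq_zero_iff.1 (congrFun hf k)
  have hΦsurj : Function.Surjective Φ := by
    intro g
    choose q hq using fun k => Ideal.Quotient.mk_surjective (g k)
    refine ⟨fun i => if hi : e i ≠ 0 then Ideal.Quotient.mk _ (q (σ ⟨i, hi⟩)) else 0, ?_⟩
    funext k
    have hk : e (σ.symm k).1 ≠ 0 := (σ.symm k).2
    rw [← hq k]
    simp only [Φ, LinearMap.pi_apply, LinearMap.comp_apply, LinearMap.proj_apply, dif_pos hk]
    simp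
    rfl
  let Ψ := φ'.trans (LinearEquiv.ofBijective Φ ⟨hΦinj, hΦsurj⟩)
  refine ⟨_, b, fun k => ⟨Nat.one_le_iff_ne_zero.2 (σ.symm k).2, ?_⟩, ?_, ⟨Ψ⟩⟩
  · have hk : (b k).2 ≠ 0 := (σ.symm k).2
    have h1 : A.charpoly • (Pi.single k 1 :
        (k : Fin (Fintype.card J)) → ℂ[X] ⧸ Ideal.span {(X - C (b k).1) ^ (b k).2}) = 0 := by
      rw [← Ψ.apply_symm_apply (Pi.single k 1), ← map_smul, hann, map_zero]
    have h2 := congrFun h1 k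
    rw [Pi.smul_apply, Pi.single_eq_same, Pi.zero_apply] at h2
    replace h2 : Ideal.Quotient.mk (Ideal.span {(X - C (b k).1) ^ (b k).2}) (A.charpoly * 1) = 0 :=
      h2
    rw [mul_one, Ideal.Quotient.eq_zero_iff_mem, Ideal.mem_span_singleton] at h2
    exact dvd_iff_isRoot.1 ((dvd_pow_self _ hk).trans h2)
  · have hfin : Module.finrank ℂ M = r := by
      rw [← (Module.AEval'.of (Matrix.toLin' A)).finrank_eq]; simp
    have hmonic : ∀ k, ((X - C (b k).1) ^ (b k).2).Monic := fun k => (monic_X_sub_C _).pow _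
    have hfree : ∀ k, Module.Finite ℂ (ℂ[X] ⧸ Ideal.span {(X - C (b k).1) ^ (b k).2}) := fun k =>
      (hmonic k).finite_quotient
    rw [← hfin, (Ψ.restrictScalars ℂ).finrank_eq, Module.finrank_pi_fintype]
    refine Finset.sum_congr rfl fun k _ => ?_
    rw [finrank_quotient_span_eq_natDegree]
    simp

/-- A set of matrices with spectra in a finite set `S` meets few conjugacy classes. -/
theorem encard_conjClasses_le (T : Set (CMat r)) (S : Finset ℂ)
    (hT : ∀ A ∈ T, ∀ l, A.charpoly.IsRoot l → l ∈ S) :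
    (ConjClasses.mk '' T).encard ≤ ((2 * S.card) ^ r : ℕ) := by
  choose n b hb hsum hequiv using exists_linearEquiv_aeval_pi (r := r)
  -- Block sizes add up to r, so this is a word of length r; for A in T its letters come from an
  -- alphabet of size 2|S|.
  let code : CMat r → List (ℂ × Bool) := fun A => (List.ofFn (b A)).flatMap blockCode
  have hpos : ∀ A, ∀ x ∈ List.ofFn (b A), 1 ≤ x.2 := by
    intro A x hx
    obtain ⟨i, rfl⟩ := (List.mem_ofFn' _ _).1 hx
    exact (hb A i).1
  have hconj : ∀ A B, code A = code B → IsConj A B := by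
    intro A B h
    have h1 : List.ofFn (b A) = List.ofFn (b B) := by
      rw [← blockDecode_flatMap _ (hpos A), ← blockDecode_flatMap _ (hpos B)]
      exact congrArg blockDecode h
    rw [List.ofFn_inj'] at h1
    have key : ∀ x y : (Σ n, Fin n → ℂ × ℕ), x = y →
        Nonempty (Module.AEval' (Matrix.toLin' A) ≃ₗ[ℂ[X]]
          ((i : Fin x.1) → ℂ[X] ⧸ Ideal.span {(X - C (x.2 i).1) ^ (x.2 i).2})) →
        Nonempty (Module.AEval' (Matrix.toLin' B) ≃ₗ[ℂ[X]]
          ((i : Fin y.1) → ℂ[X] ⧸ Ideal.span {(X - C (y.2 i).1) ^ (y.2 i).2})) → IsConj A B := by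
      rintro x _ rfl ⟨φ⟩ ⟨ψ⟩
      exact isConj_of_linearEquiv_aeval (φ.trans ψ.symm)
    exact key _ _ h1 (hequiv A) (hequiv B)
  refine le_trans ?_ (encard_lists_le S r)
  have hrep : ∀ c ∈ ConjClasses.mk '' T, ∃ A ∈ T, ConjClasses.mk A = c := fun c hc => hc
  choose! rep hrepT hrep using hrep
  refine Set.encard_le_encard_of_injOn (f := fun c => code (rep c)) ?_ ?_
  · intro c hc
    refine ⟨?_, fun x hx => ?_⟩
    · rw [length_flatMap_blockCode _ (hpos _), List.map_ofFn, List.sum_ofFn]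
      exact hsum _
    · obtain ⟨y, hy, hyx⟩ := fst_mem_of_mem_flatMap_blockCode _ hx
      obtain ⟨i, rfl⟩ := (List.mem_ofFn' _ _).1 hy
      rw [← hyx]
      exact hT _ (hrepT c hc) _ (hb _ i).2
  · intro c hc c' hc' h
    rw [← hrep c hc, ← hrep c' hc']
    exact ConjClasses.mk_eq_mk_iff_isConj.2 (hconj _ _ h)

end ConjugacyClasses

/-! ### Torsion values of independent algebraic functions. -/

/-- Two nonzero algebraic functions such that no monomial in them is constant. -/
structure MultIndependentModConstants (μ η : AlgFun) : Prop where
  left_ne_zero : μ ≠ 0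
  right_ne_zero : η ≠ 0
  ne_const : ∀ k : ℤ × ℤ, k ≠ 0 → ∀ c : ℂ, μ ^ k.1 * η ^ k.2 ≠ algebraMap ℂ AlgFun c

theorem exists_eq_sparse (P : ℂ[X][Y]) :
    ∃ (s : Finset (ℕ × ℕ)) (c : ℕ × ℕ → ℂ), (∀ v ∈ s, c v ≠ 0) ∧ P = sparse 1 s c := by
  classical
  let c : ℕ × ℕ → ℂ := fun v => (P.coeff v.2).coeff v.1
  let s := (Finset.range (xDegree P + 1) ×ˢ Finset.range (P.natDegree + 1)).filter (c · ≠ 0)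
  refine ⟨s, c, fun v hv => (Finset.mem_filter.1 hv).2, ?_⟩
  have hs : ∀ v, c v ≠ 0 → v ∈ s := by
    intro v hv
    refine Finset.mem_filter.2 ⟨Finset.mem_product.2 ⟨?_, ?_⟩, hv⟩
    · exact Finset.mem_range_succ_iff.2 ((le_natDegree_of_ne_zero hv).trans
        (natDegree_coeff_le_xDegree P v.2))
    · refine Finset.mem_range_succ_iff.2 (le_natDegree_of_ne_zero fun h => hv ?_)
      simp [c, h]
  ext j i
  by_cases h : c (i, j) = 0
  · rw [show (P.coeff j).coeff i = 0 from h, sparse, finsetSum_coeff, finsetSum_coeff]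
    refine (Finset.sum_eq_zero fun v hv => ?_).symm
    simp only [coeff_monomial, one_mul]
    split_ifs with h1
    · rw [coeff_monomial, if_neg]
      rintro rfl
      subst h1
      exact (Finset.mem_filter.1 hv).2 h
    · simp
  · have := coeff_coeff_sparse (m := 1) (c := c) one_pos (hs _ h)
    simp only [one_mul] at this
    rw [this]

theorem exists_eq_algebraMap_of_aeval_eq_zero {S : AlgFun} {Φ : ℂ[X]} (hΦ : Φ ≠ 0)
    (h : aeval S Φ = 0) : ∃ c : ℂ, S = algebraMap ℂ AlgFun c := by
  have hint : IsIntegral ℂ S := isAlgebraic_iff_isIntegral.1 ⟨Φ, hΦ, h⟩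
  have hdeg := IsAlgClosed.degree_eq_one_of_irreducible ℂ (minpoly.irreducible hint)
  obtain ⟨c, hc⟩ := minpoly.degree_eq_one_iff.1 hdeg
  exact ⟨c, hc.symm⟩

/-- The exponents of a polynomial vanishing at independent functions do not lie on a line. -/
theorem MultIndependentModConstants.not_collinear {μ η : AlgFun}
    (hind : MultIndependentModConstants μ η) {s : Finset (ℕ × ℕ)} {c : ℕ × ℕ → ℂ}
    (hc : ∀ v ∈ s, c v ≠ 0) {v₀ : ℕ × ℕ} (hv₀ : v₀ ∈ s)
    (h0 : aevalAeval μ η (sparse 1 s c) = 0) (u : ℤ × ℤ) :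
    ¬ ∀ v ∈ s, ∃ k : ℤ, (v.1 : ℤ) = v₀.1 + k * u.1 ∧ (v.2 : ℤ) = v₀.2 + k * u.2 := by
  classical
  intro h
  choose! k hk1 hk2 using h
  have hμ := hind.left_ne_zero
  have hη := hind.right_ne_zero
  set S := μ ^ u.1 * η ^ u.2 with hS
  have hS0 : S ≠ 0 := mul_ne_zero (zpow_ne_zero _ hμ) (zpow_ne_zero _ hη)
  have hinj : ∀ v ∈ s, k v = k v₀ → v = v₀ := by
    intro v hv hkv
    have e1 := hk1 v hv
    have e2 := hk2 v hv
    rw [hkv] at e1 e2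
    have e3 := hk1 v₀ hv₀
    have e4 := hk2 v₀ hv₀
    exact Prod.ext (by omega) (by omega)
  have hsum : ∑ v ∈ s, algebraMap ℂ AlgFun (c v) * S ^ k v = 0 := by
    rw [aevalAeval_sparse] at h0
    refine (mul_eq_zero.1 (?_ : μ ^ v₀.1 * η ^ v₀.2 * _ = 0)).resolve_left
      (mul_ne_zero (pow_ne_zero _ hμ) (pow_ne_zero _ hη))
    rw [← h0, Finset.mul_sum]
    refine Finset.sum_congr rfl fun v hv => ?_
    rw [pow_one, ← zpow_natCast μ v.1, ← zpow_natCast η v.2, hk1 v hv, hk2 v hv, hS, mul_zpow,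
      zpow_add₀ hμ, zpow_add₀ hη, ← zpow_mul, ← zpow_mul, mul_comm (k v), mul_comm (k v),
      zpow_natCast, zpow_natCast]
    ring
  by_cases hu : u = 0
  · have hsing : s = {v₀} := by
      refine Finset.eq_singleton_iff_unique_mem.2 ⟨hv₀, fun v hv => ?_⟩
      have e1 := hk1 v hv
      have e2 := hk2 v hv
      simp only [hu, Prod.fst_zero, Prod.snd_zero, mul_zero, add_zero, Nat.cast_inj] at e1 e2
      exact Prod.ext e1 e2
    rw [hsing, Finset.sum_singleton, mul_eq_zero] at hsum
    rcases hsum with h1 | h1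
    · exact hc v₀ hv₀ ((map_eq_zero _).1 h1)
    · exact zpow_ne_zero _ hS0 h1
  · set M := ∑ v ∈ s, (k v).natAbs
    have hM : ∀ v ∈ s, 0 ≤ k v + M := by
      intro v hv
      have := Finset.single_le_sum (f := fun v => (k v).natAbs) (fun _ _ => Nat.zero_le _) hv
      omega
    -- The shift by M clears negative exponents. Then S is algebraic over ℂ, hence constant, against
    -- independence.
    set Φ : ℂ[X] := ∑ v ∈ s, monomial (k v + M).toNat (c v) with hΦ
    have hcoeff : Φ.coeff (k v₀ + M).toNat = c v₀ := by
      rw [hΦ, finsetSum_coeff, Finset.sum_eq_single v₀]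
      · simp
      · intro v hv hne
        rw [coeff_monomial, if_neg]
        intro heq
        have e1 := hM v hv
        have e2 := hM v₀ hv₀
        exact hne (hinj v hv (by omega))
      · exact fun h => absurd hv₀ h
    have hΦ0 : Φ ≠ 0 := fun h => hc v₀ hv₀ (by rw [← hcoeff, h, coeff_zero])
    have hroot : aeval S Φ = 0 := by
      rw [hΦ, map_sum, ← mul_zero (S ^ M), ← hsum, Finset.mul_sum]
      refine Finset.sum_congr rfl fun v hv => ?_
      rw [aeval_monomial, ← zpow_natCast S (k v + M).toNat, Int.toNat_of_nonneg (hM v hv),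
        zpow_add₀ hS0, zpow_natCast]
      ring
    obtain ⟨a, ha⟩ := exists_eq_algebraMap_of_aeval_eq_zero hΦ0 hroot
    exact hind.ne_const u hu a ha

/-- An irreducible plane curve through an independent pair of functions has few torsion points. -/
theorem exists_torsion_finset_of_irreducible {P : ℂ[X][Y]} (hP : Irreducible P) {μ η : AlgFun}
    (hind : MultIndependentModConstants μ η) (hz : aevalAeval μ η P = 0) :
    ∃ T : Finset ℂ, T.card ≤ 22 * (xDegree P * P.natDegree) ∧
      ∀ y z : ℂ, IsOfFinOrder y → IsOfFinOrder z → P.evalEval y z = 0 → y ∈ T := by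
  obtain ⟨s, c, hc, rfl⟩ := exists_eq_sparse P
  obtain ⟨v₀, hv₀⟩ : s.Nonempty := by
    rw [Finset.nonempty_iff_ne_empty]
    rintro rfl
    exact hP.ne_zero (by simp [sparse])
  obtain ⟨χ, rfl⟩ := exists_latticeChart hv₀ (hind.not_collinear hc hv₀ hz)
  have hd : IsUnit (C (C (c χ.base)⁻¹) : ℂ[X][Y]) :=
    isUnit_C.2 (isUnit_C.2 (inv_ne_zero (hc _ hv₀)).isUnit)
  -- Otherwise all exponents lie on the horizontal axis.
  have hs : 0 < s.sup Prod.snd := by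
    rw [Nat.pos_iff_ne_zero]
    intro h
    have hzero : ∀ v ∈ s, v.2 = 0 := fun v hv => Nat.le_zero.1 (h ▸ Finset.le_sup (f := Prod.snd) hv)
    refine hind.not_collinear hc hv₀ hz (1, 0) fun v hv => ⟨v.1 - χ.base.1, by simp, ?_⟩
    simp [hzero v hv, hzero _ hv₀]
  obtain ⟨T, hT, hT'⟩ := χ.exists_torsion_finset hs (c := fun v => (c χ.base)⁻¹ * c v)
    (fun v hv => mul_ne_zero (inv_ne_zero (hc _ hv₀)) (hc v hv)) (inv_mul_cancel₀ (hc _ hv₀))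
    (by rw [sparse_const_mul, irreducible_isUnit_mul hd]; exact hP)
  refine ⟨T, by rwa [xDegree_sparse_one hc, natDegree_sparse_one hc], fun y z hy hz' h => ?_⟩
  obtain ⟨g, rfl⟩ := hy.isUnit
  obtain ⟨h', rfl⟩ := hz'.isUnit
  refine hT' g h' (Units.isOfFinOrder_val.1 hy) (Units.isOfFinOrder_val.1 hz') ?_
  rw [sparse_const_mul, evalEval_mul, h, mul_zero]

/-- Points of the line at which two algebraic functions both take roots of unity as values. -/
theorem exists_finset_torsion_values {F G : ℂ[X][Y]} (hF : F.Monic) (hG : G.Monic)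
    (hFy : ∀ y : ℂ, IsOfFinOrder y → (swap F).map (evalRingHom y) ≠ 0)
    (hind : ∀ l y z : ℂ, IsOfFinOrder y → IsOfFinOrder z → F.evalEval l y = 0 →
      G.evalEval l z = 0 → ∃ μ η : AlgFun, MultIndependentModConstants μ η ∧
        aevalAeval AlgFun.x μ F = 0 ∧ aevalAeval AlgFun.x η G = 0 ∧
        ∀ H : ℂ[X][Y], aevalAeval μ η H = 0 → H.evalEval y z = 0) :
    ∃ S : Finset ℂ,
      S.card ≤ 22 * ((xDegree G * F.natDegree) * (xDegree F * G.natDegree)) * xDegree F ∧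
      ∀ l y z : ℂ, IsOfFinOrder y → IsOfFinOrder z → F.evalEval l y = 0 → G.evalEval l z = 0 →
        l ∈ S := by
  classical
  have hroots : ∀ l y : ℂ, IsOfFinOrder y → F.evalEval l y = 0 →
      l ∈ ((swap F).map (evalRingHom y)).roots.toFinset := by
    intro l y hy h
    rw [Multiset.mem_toFinset, mem_roots (hFy y hy), IsRoot.def, map_evalRingHom_eval,
      ← coe_aevalAeval_eq_evalEval, aevalAeval_swap, coe_aevalAeval_eq_evalEval, h]
  have hcard : ∀ y : ℂ, ((swap F).map (evalRingHom y)).roots.toFinset.card ≤ xDegree F := fun y =>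
    (Multiset.toFinset_card_le _).trans ((card_roots' _).trans natDegree_map_le)
  rcases Nat.eq_zero_or_pos (xDegree F) with hp | hp
  · refine ⟨∅, by simp, fun l y z hy _ h _ => ?_⟩
    have h1 := hcard y
    rw [hp, Nat.le_zero, Finset.card_eq_zero] at h1
    exact absurd (hroots l y hy h) (h1 ▸ Finset.notMem_empty l)
  obtain ⟨R, hR0, hRx, hRz, hR⟩ := exists_eliminant hG hF.ne_zero hp
  set 𝓕 := (UniqueFactorizationMonoid.factors R).toFinset
  have hirr : ∀ P ∈ 𝓕, Irreducible P := fun P hP =>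
    UniqueFactorizationMonoid.irreducible_of_factor P (Multiset.mem_toFinset.1 hP)
  have hprod : ∏ P ∈ 𝓕, P ∣ R := by
    refine dvd_trans ?_ (UniqueFactorizationMonoid.factors_prod hR0).dvd
    rw [Finset.prod_eq_multiset_prod, Multiset.map_id', Multiset.toFinset_val]
    exact Multiset.prod_dvd_prod_of_le (Multiset.dedup_le _)
  have hsx : ∑ P ∈ 𝓕, xDegree P ≤ xDegree R := by
    rw [← xDegree_prod 𝓕 (fun P => P) fun P hP => (hirr P hP).ne_zero]
    exact xDegree_le_of_dvd hprod hR0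
  have hsz : ∑ P ∈ 𝓕, P.natDegree ≤ R.natDegree := by
    rw [← natDegree_prod _ _ fun P hP => (hirr P hP).ne_zero]
    exact natDegree_le_of_dvd hprod hR0
  -- Factors through no independent pair may carry infinitely many torsion points; they get the
  -- empty set and are never needed.
  have hT : ∀ P : ℂ[X][Y], ∃ T : Finset ℂ, (P ∈ 𝓕 → T.card ≤ 22 * (xDegree P * P.natDegree)) ∧
      (P ∈ 𝓕 → (∃ μ η : AlgFun, MultIndependentModConstants μ η ∧ aevalAeval μ η P = 0) →
        ∀ y z : ℂ, IsOfFinOrder y → IsOfFinOrder z → P.evalEval y z = 0 → y ∈ T) := by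
    intro P
    by_cases h : P ∈ 𝓕 ∧ ∃ μ η : AlgFun, MultIndependentModConstants μ η ∧ aevalAeval μ η P = 0
    · obtain ⟨hP, μ, η, h1, h2⟩ := h
      obtain ⟨T, h3, h4⟩ := exists_torsion_finset_of_irreducible (hirr P hP) h1 h2
      exact ⟨T, fun _ => h3, fun _ _ => h4⟩
    · exact ⟨∅, by simp, fun h1 h2 => absurd ⟨h1, h2⟩ h⟩
  choose T hTcard hT using hT
  refine ⟨𝓕.biUnion fun P => (T P).biUnion fun y => ((swap F).map (evalRingHom y)).roots.toFinset,
    ?_, fun l y z hy hz h1 h2 => ?_⟩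
  · calc _ ≤ ∑ P ∈ 𝓕, ((T P).biUnion fun y =>
          ((swap F).map (evalRingHom y)).roots.toFinset).card := Finset.card_biUnion_le
      _ ≤ ∑ P ∈ 𝓕, 22 * (xDegree P * ∑ P ∈ 𝓕, P.natDegree) * xDegree F := by
        refine Finset.sum_le_sum fun P hP => ?_
        refine (Finset.card_biUnion_le_card_mul _ _ _ fun y _ => hcard y).trans ?_
        refine Nat.mul_le_mul_right _ ((hTcard P hP).trans ?_)
        gcongr
        exact Finset.single_le_sum (f := fun P : ℂ[X][Y] => P.natDegree)
          (fun _ _ => Nat.zero_le _) hP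
      _ = 22 * ((∑ P ∈ 𝓕, xDegree P) * ∑ P ∈ 𝓕, P.natDegree) * xDegree F := by
        rw [← Finset.sum_mul, ← Finset.mul_sum, ← Finset.sum_mul]
      _ ≤ _ := by
        gcongr
        · exact hsx.trans hRx
        · exact hsz.trans hRz
  -- The factor is selected by its vanishing at (μ, η), not at (y, z); specialization then gives the
  -- latter.
  · obtain ⟨μ, η, hμη, hμ, hη, hspec⟩ := hind l y z hy hz h1 h2
    have h3 : aevalAeval μ η R = 0 := hR AlgFun.x μ η hμ hη
    obtain ⟨w, hw⟩ := UniqueFactorizationMonoid.factors_prod hR0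
    rw [← hw, map_mul, mul_eq_zero, or_iff_left (w.isUnit.map (aevalAeval μ η)).ne_zero,
      map_multiset_prod, Multiset.prod_eq_zero_iff] at h3
    obtain ⟨P, hP, hP0⟩ := Multiset.mem_map.1 h3
    have hP' : P ∈ 𝓕 := Multiset.mem_toFinset.2 hP
    exact Finset.mem_biUnion.2 ⟨P, hP', Finset.mem_biUnion.2
      ⟨y, hT P hP' ⟨μ, η, hμη, hP0⟩ y z hy hz (hspec P hP0), hroots l y hy h1⟩⟩

/-! ### Independence modulo constants, and the set of eigenvalues. -/

section Independence

variable {r : ℕ} {f g : (CMat r)[X]}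

/-- A monomial in μ, η equal to a constant c specializes to the same monomial in y, z, so c is a
root of unity; a power of the relation is then a multiplicative dependence. -/
theorem MultIndependent.multIndependentModConstants {μ η : AlgFun} (h : MultIndependent μ η)
    {y z : ℂ} (hy : IsOfFinOrder y) (hz : IsOfFinOrder z)
    (hspec : ∀ H : ℂ[X][Y], aevalAeval μ η H = 0 → H.evalEval y z = 0) :
    MultIndependentModConstants μ η := by
  have hy0 : y ≠ 0 := hy.isUnit.ne_zero
  have hz0 : z ≠ 0 := hz.isUnit.ne_zero
  have hμ : μ ≠ 0 := by
    rintro rfl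
    exact hy0 (by simpa [evalEval_C] using hspec (C X) (aevalAeval_X _ _))
  have hη : η ≠ 0 := by
    rintro rfl
    exact hz0 (by simpa using hspec Y (aevalAeval_Y _ _))
  refine ⟨hμ, hη, fun k hk c hc => h ?_⟩
  have hfrac : ∀ {F : Type} [Field F] {x : F} (_ : x ≠ 0) (n : ℤ),
      x ^ n = x ^ n.toNat / x ^ (-n).toNat := by
    intro F _ x hx n
    rw [eq_div_iff (pow_ne_zero _ hx), ← zpow_natCast, ← zpow_natCast, ← zpow_add₀ hx]
    congr 1
    omega
  have hyz : y ^ k.1 * z ^ k.2 = c := by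
    have h1 := hspec (C X ^ k.1.toNat * Y ^ k.2.toNat -
      C (C c) * (C X ^ (-k.1).toNat * Y ^ (-k.2).toNat)) (by
        rw [hfrac hμ, hfrac hη, div_mul_div_comm, div_eq_iff (mul_ne_zero (pow_ne_zero _ hμ)
          (pow_ne_zero _ hη))] at hc
        simp only [map_sub, map_mul, map_pow, aevalAeval_Y, aevalAeval_C, aeval_X, aeval_C]
        rw [hc, sub_self])
    rw [hfrac hy0, hfrac hz0, div_mul_div_comm, div_eq_iff (mul_ne_zero (pow_ne_zero _ hy0)
          (pow_ne_zero _ hz0)), ← sub_eq_zero]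
    simpa [evalEval_C] using h1
  obtain ⟨n, hn, hyn⟩ := isOfFinOrder_iff_pow_eq_one.1 hy
  obtain ⟨m, hm, hzm⟩ := isOfFinOrder_iff_pow_eq_one.1 hz
  have hcn : c ^ (n * m) = 1 := by
    rw [← hyz, mul_pow, ← zpow_natCast, ← zpow_natCast, zpow_comm, zpow_comm z, zpow_natCast,
      zpow_natCast, pow_mul, hyn, mul_comm n, pow_mul z, hzm]
    simp
  have hnm : ((n * m : ℕ) : ℤ) ≠ 0 := by
    exact_mod_cast (Nat.mul_pos hn hm).ne'
  refine ⟨(k.1 * (n * m : ℕ), k.2 * (n * m : ℕ)), fun h0 => hk (Prod.ext ?_ ?_), ?_⟩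
  · exact (mul_eq_zero.1 (congrArg Prod.fst h0)).resolve_right hnm
  · exact (mul_eq_zero.1 (congrArg Prod.snd h0)).resolve_right hnm
  · rw [zpow_mul, zpow_mul, ← mul_zpow, hc, zpow_natCast, ← map_pow, hcn, map_one]

theorem exists_isEigenvalueAtScalarVariable (hr : 1 ≤ r) (f : (CMat r)[X]) :
    ∃ μ, IsEigenvalueAtScalarVariable f μ := by
  have : Nonempty (Fin r) := ⟨⟨0, hr⟩⟩
  exact Module.End.exists_eigenvalue _

/-- Otherwise the constant y would be an eigenvalue of f(xI), and a root of unity is dependent on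
anything. -/
theorem map_swap_charpolyAtScalar_ne_zero
    (h : ∀ μ, IsEigenvalueAtScalarVariable f μ → ∃ η, MultIndependent μ η) {y : ℂ}
    (hy : IsOfFinOrder y) : (swap (charpolyAtScalar f)).map (evalRingHom y) ≠ 0 := by
  intro h0
  obtain ⟨η, hη⟩ := h (algebraMap ℂ AlgFun y) (by
    rw [isEigenvalueAtScalarVariable_iff, ← aevalAeval_swap, ← map_zero (aeval AlgFun.x : ℂ[X] →ₐ[ℂ] AlgFun), ← h0]
    refine congrArg (fun φ : ℂ[X][Y] →+* AlgFun => φ (swap (charpolyAtScalar f)))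
      (?_ : (aevalAeval (algebraMap ℂ AlgFun y) AlgFun.x : ℂ[X][Y] →ₐ[ℂ] AlgFun).toRingHom =
        ((aeval AlgFun.x : ℂ[X] →ₐ[ℂ] AlgFun) : ℂ[X] →+* AlgFun).comp (mapRingHom (evalRingHom y)))
    ext <;> simp)
  obtain ⟨n, hn, hyn⟩ := isOfFinOrder_iff_pow_eq_one.1 hy
  refine hη ⟨(n, 0), fun h1 => ?_, ?_⟩
  · have : (n : ℤ) = 0 := congrArg Prod.fst h1
    omega
  · rw [zpow_natCast, ← map_pow, hyn, map_one, zpow_zero, mul_one]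

theorem exists_finset_eigenvalues (hr : 1 ≤ r)
    (hfg : ∀ μ η : AlgFun, IsEigenvalueAtScalarVariable f μ → IsEigenvalueAtScalarVariable g η →
      MultIndependent μ η) :
    ∃ S : Finset ℂ, S.card ≤ 22 * ((r * g.natDegree * r) * (r * f.natDegree * r)) * (r * f.natDegree) ∧
      ∀ l y z : ℂ, IsOfFinOrder y → IsOfFinOrder z → (charpolyAtScalar f).evalEval l y = 0 →
        (charpolyAtScalar g).evalEval l z = 0 → l ∈ S := by
  obtain ⟨η₀, hη₀⟩ := exists_isEigenvalueAtScalarVariable hr g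
  obtain ⟨S, hS, hS'⟩ := exists_finset_torsion_values (charpolyAtScalar_monic f)
    (charpolyAtScalar_monic g)
    (fun y hy => map_swap_charpolyAtScalar_ne_zero (fun μ hμ => ⟨η₀, hfg μ η₀ hμ hη₀⟩) hy)
    (fun l y z hy hz h1 h2 => by
      obtain ⟨μ, η, hμ, hη, hspec⟩ := exists_specialization (charpolyAtScalar_monic f)
        (charpolyAtScalar_monic g) h1 h2
      exact ⟨μ, η, (hfg μ η ((isEigenvalueAtScalarVariable_iff f μ).2 hμ)
        ((isEigenvalueAtScalarVariable_iff g η).2 hη)).multIndependentModConstants hy hz hspec,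
        hμ, hη, hspec⟩)
  refine ⟨S, hS.trans ?_, hS'⟩
  rw [natDegree_charpolyAtScalar, natDegree_charpolyAtScalar]
  have h1 := xDegree_charpolyAtScalar_le f
  have h2 := xDegree_charpolyAtScalar_le g
  gcongr

theorem MultIndependent.symm {μ η : AlgFun} (h : MultIndependent μ η) : MultIndependent η μ := by
  rintro ⟨k, hk, h1⟩
  refine h ⟨(k.2, k.1), fun h0 => hk (Prod.ext ?_ ?_), by rw [mul_comm, h1]⟩
  · exact congrArg Prod.snd h0
  · exact congrArg Prod.fst h0

end Independence

end

/-- `ConjClasses (CMat r)` is the set of classes of `M_r(ℂ)` under `B ↦ V * B * V⁻¹` with `V`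
invertible. -/
theorem theorem1p4 (r : ℕ) (hr : 1 ≤ r) (f g : (CMat r)[X])
    (hfg : ∀ μ η : AlgFun, IsEigenvalueAtScalarVariable f μ → IsEigenvalueAtScalarVariable g η →
      MultIndependent μ η) :
    (ConjClasses.mk '' commutingTorsionSet f g).encard ≤
      ((2 * (22 * r ^ 5 * (f.natDegree + g.natDegree) * (f.natDegree * g.natDegree)) ^ r : ℕ) :
        ℕ∞) := by
  obtain ⟨S, hcard, hS⟩ : ∃ S : Finset ℂ,
      2 * S.card ≤ 22 * r ^ 5 * (f.natDegree + g.natDegree) * (f.natDegree * g.natDegree) ∧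
      ∀ l y z : ℂ, IsOfFinOrder y → IsOfFinOrder z → (charpolyAtScalar f).evalEval l y = 0 →
        (charpolyAtScalar g).evalEval l z = 0 → l ∈ S := by
    -- The estimate has the factor 2 · deg f, or 2 · deg g with the roles exchanged; the smaller one
    -- is at most the sum of the degrees.
    rcases le_total f.natDegree g.natDegree with h | h
    · obtain ⟨S, h1, h2⟩ := exists_finset_eigenvalues hr hfg
      refine ⟨S, ?_, h2⟩
      calc 2 * S.card ≤ 22 * r ^ 5 * (f.natDegree + f.natDegree) * (f.natDegree * g.natDegree) := by
            refine (Nat.mul_le_mul_left 2 h1).trans (le_of_eq ?_)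
            ring
        _ ≤ _ := by gcongr
    · obtain ⟨S, h1, h2⟩ := exists_finset_eigenvalues hr (f := g) (g := f)
        fun μ η hμ hη => (hfg η μ hη hμ).symm
      refine ⟨S, ?_, fun l y z hy hz hf hg => h2 l z y hz hy hg hf⟩
      calc 2 * S.card ≤ 22 * r ^ 5 * (g.natDegree + g.natDegree) * (f.natDegree * g.natDegree) := by
            refine (Nat.mul_le_mul_left 2 h1).trans (le_of_eq ?_)
            ring
        _ ≤ _ := by gcongr
  have hspec : ∀ A ∈ commutingTorsionSet f g, ∀ l, A.charpoly.IsRoot l → l ∈ S := by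
    rintro A ⟨hf, hg, ⟨n, hn, hfn⟩, ⟨m, hm, hgm⟩⟩ l hl
    obtain ⟨y, hy, hy0⟩ := exists_evalEval_charpolyAtScalar_eq_zero f hf hfn hl
    obtain ⟨z, hz, hz0⟩ := exists_evalEval_charpolyAtScalar_eq_zero g hg hgm hl
    exact hS l y z (isOfFinOrder_iff_pow_eq_one.2 ⟨n, hn, hy⟩)
      (isOfFinOrder_iff_pow_eq_one.2 ⟨m, hm, hz⟩) hy0 hz0
  refine (encard_conjClasses_le _ S hspec).trans (Nat.cast_le.2 ?_)
  refine (Nat.pow_le_pow_left hcard r).trans ?_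
  omega
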